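/- **Theorem 4.1 (Strang-type estimate).** *Setting.* Let $\Omega\subset\mathbb R^2$ be open and convex and let $\mathcal T_h$ be a subdivision of $\Omega$ into finitely many non-overlapping simple polygons $K$, of diameter $h_K$, such that two edges of different elements either coincide or have disjoint relative interiors. Let $\mathcal E_h^B$ be the set of edges contained in $\partial\Omega$, let $n_K$ be the outward unit normal of $K$ and $\tau_K$ its counter-clockwise unit tangent; on a boundary edge write $n_e$ for the outward normal. Let $\|u\|_{2,h}^2=\sum_K\|u\|_{H^2(K)}^2$, where $\|u\|_{H^2(K)}^2=\int_K u^2+|\nabla u|^2+|D^2u|^2$ with the Frobenius norm of $D^2u$. Let $W=H^2(\Omega)\cap H^1_0(\Omega)$, let $\ell\ge 2$, let $\mathbb P_m$ denote the polynomials of degree at most $m$ ($\mathbb P_m=\{0\}$ for $m<0$), and $\mathbb P_\ell(\mathcal T_h)$ the functions that are in $\mathbb P_\ell(K)$ on each $K$. Let $\varepsilon>0$, let $u_\varepsilon\in H^2(\Omega)$ have a bounded Hessian, and put $\Phi=\operatorname{cof}(D^2u_\varepsilon)$; assume that for some $\beta>0$, $\xi^\top\Phi\,\xi\ge\beta|\xi|^2$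 for all $\xi\in\mathbb R^2$ a.e. in $\Omega$ (for instance, $u_\varepsilon$ is the solution of the vanishing moment problem $-\varepsilon\Delta^2u_\varepsilon+\det D^2u_\varepsilon=f$ in $\Omega$, $u_\varepsilon=g$, $\Delta u_\varepsilon=\varepsilon$ on $\partial\Omega$, if it has these properties). For an open set $D\subset\Omega$ put $$A_L^D(u,w)=\varepsilon\int_D D^2u:D^2w\,dx+\int_D\Phi\nabla u\cdot\nabla w\,dx .$$ *Virtual element space.* For each $K$ let $$\widetilde V^K=\{v\in H^2(K):\Delta^2v\in\mathbb P_\ell(K),\ v|_e\in\mathbb P_\ell(e),\ \Delta v|_e\in\mathbb P_{\ell-2}(e)\text{ for all edges }e\text{ of }K\}.$$ The degrees of freedom $\Lambda^K$ are the values at the vertices of $K$, the moments $\frac1{|e|}\int_e v\,p\,ds$ and $\int_e\partial_{n_K}v\,p\,ds$ with $p$ in given bases of $\mathbb P_{\ell-2}(e)$, and the moments $\frac1{|K|}\int_Kv\,p\,dx$ with $p$ in a given basis of $\mathbb P_{\ell-4}(K)$. Let $\Pi^K:\widetilde V^K\to\mathbb P_\ell(K)$, $\Pi^e:\widetilde V^K\to\mathbb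 P_\ell(e)$ and $N^e:\widetilde V^K\to\mathbb P_{\ell-1}(e)$ be any linear combinations of the degrees of freedom $\Lambda^K(v)$ such that $\Pi^Kv-v$ is orthogonal to $\mathbb P_{\ell-4}(K)$; $\Pi^ev$ equals $v$ at the endpoints of $e$ and $\Pi^ev-v$ is orthogonal to $\mathbb P_{\ell-2}(e)$; $N^ev-\partial_{n_K}v$ is orthogonal to $\mathbb P_{\ell-2}(e)$; and $\Pi^Kq=q$, $\Pi^eq=q|_e$, $N^eq=\partial_{n_K}q|_e$ for all $q\in\mathbb P_\ell(K)$. Let $\Pi_1^Kv\in[\mathbb P_{\ell-1}(K)]^2$ and $\Pi_2^Kv\in[\mathbb P_{\ell-2}(K)]^{2\times2}$ be given by $$\int_K\Pi_1^Kv\cdot p=-\int_K\Pi^Kv\,\operatorname{div}p+\sum_{e\subset\partial K}\int_e\Pi^ev\;p\cdot n_K\,ds\qquad\forall p\in[\mathbb P_{\ell-1}(K)]^2,$$ $$\int_K\Pi_2^Kv:p=-\int_K\Pi_1^Kv\cdot\operatorname{div}p+\sum_{e\subset\partial K}\int_e\bigl(N^ev\,(n_K\otimes n_K)+\partial_e(\Pi^ev)\,(\tau_K\otimes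 n_K)\bigr):p\,ds\qquad\forall p\in[\mathbb P_{\ell-2}(K)]^{2\times2},$$ where $\partial_e$ is the derivative along $e$ in the direction $\tau_K$. Let $V_h^K$ be the set of $v\in\widetilde V^K$ with $\int_K(v-\Pi^Kv)p\,dx=0$ for all $p\in\mathbb P_\ell(K)\setminus\mathbb P_{\ell-4}(K)$, and let $V_h$ be the set of $v\in H^1_0(\Omega)$ with $v|_K\in V_h^K$ for all $K$ and $\int_e[\![\partial_{n_e}v]\!]\,p\,ds=0$ for all $p\in\mathbb P_{\ell-2}(e)$ and all interior edges $e$ (for these, $n_e$ is either of the two unit normals). The discrete forms are $$A_{L,h}^K(u,w)=\varepsilon\int_K\Pi_2^Ku:\Pi_2^Kw\,dx+\int_K\Phi\,\Pi_1^Ku\cdot\Pi_1^Kw\,dx+\bigl(\varepsilon h_K^{-2}+\|\Phi\|_{L^\infty(K)}\bigr)\sum_{\lambda\in\Lambda^K}\lambda(u-\Pi^Ku)\,\lambda(w-\Pi^Kw).$$ *Constants.* Let $C_2,C_3,\alpha_*,\alpha^*>0$ be such that * $A_L^K(u,w)\le C_2\|u\|_{H^2(K)}\|w\|_{H^2(K)}$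 for all $K$ and all $u,w\in H^2(K)$, * $\sum_KA_L^K(w,w)\ge C_3\|w\|_{2,h}^2$ for all $w\in V_h$, * $\alpha_*A_L^K(w,w)\le A_{L,h}^K(w,w)\le\alpha^*A_L^K(w,w)$ for all $K$ and all $w\in V_h^K$. *Claim.* Let $\varphi\in L^2(\Omega)$ and $\psi\in L^2(\partial\Omega)$. Let $v\in W$ satisfy $A_L^\Omega(v,w)=\int_\Omega\varphi w\,dx+\varepsilon\int_{\partial\Omega}\psi\,\partial_nw\,ds$ for all $w\in W$, and let $v_h\in V_h$ satisfy $\sum_KA_{L,h}^K(v_h,w)=\int_\Omega\varphi w\,dx+\varepsilon\sum_{e\in\mathcal E_h^B}\int_e\psi\,N^ew\,ds$ for all $w\in V_h$. Then $$\begin{aligned}C_3\alpha_*\|v-v_h\|_{2,h}\le{}&(\alpha^*C_2+C_3\alpha_*)\inf_{w\in V_h}\|v-w\|_{2,h}\\&+\inf_{p\in\mathbb P_\ell(\mathcal T_h)}\Bigl((1+\alpha^*)C_2\|v-p\|_{2,h}+\sum_K\sup_{0\ne\delta\in V_h}\frac{|A_L^K(p,\delta)-A_{L,h}^K(p,\delta)|}{\|\delta\|_{2,h}}\Bigr)\\&+\sup_{0\ne\delta\in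 V_h}\frac{|E(v,\delta)|}{\|\delta\|_{2,h}}+\sup_{0\ne\delta\in V_h}\frac{\bigl|\varepsilon\sum_{e\in\mathcal E_h^B}\int_e\psi\,(N^e\delta-\partial_{n_e}\delta)\,ds\bigr|}{\|\delta\|_{2,h}},\end{aligned}$$ where $E(v,\delta)=\int_\Omega\varphi\,\delta\,dx-\sum_KA_L^K(v,\delta)+\varepsilon\sum_{e\in\mathcal E_h^B}\int_e\psi\,\partial_{n_e}\delta\,ds$. -/

import Mathlib

open MeasureTheory Filter Topology Set
open scoped ENNReal ContDiff Matrix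

noncomputable section

namespace VEM

/-- The Euclidean plane. -/
abbrev Pt := EuclideanSpace ℝ (Fin 2)

/-! ### Sobolev spaces through weak derivatives -/

/-- The classical partial derivative `∂φ/∂x_i`. -/
def pd (i : Fin 2) (φ : Pt → ℝ) (x : Pt) : ℝ := fderiv ℝ φ x (EuclideanSpace.single i 1)

/-- Smooth test functions with compact support in the open set `D`. -/
def IsTest (D : Set Pt) (φ : Pt → ℝ) : Prop :=
  ContDiff ℝ ∞ φ ∧ HasCompactSupport φ ∧ tsupport φ ⊆ D

/-- `g ∈ L²(D)` is the weak derivative `∂u/∂x_i` of `u` on `D`. -/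
def HasWeakDeriv (D : Set Pt) (i : Fin 2) (u g : Pt → ℝ) : Prop :=
  MemLp g 2 (volume.restrict D) ∧
    ∀ φ, IsTest D φ → ∫ x in D, u x * pd i φ x = - ∫ x in D, g x * φ x

open Classical in
/-- The weak derivative `∂u/∂x_i` on `D` (unique almost everywhere on `D`; `0` if there is none in
`L²(D)`). -/
def weakD (D : Set Pt) (i : Fin 2) (u : Pt → ℝ) : Pt → ℝ :=
  if h : ∃ g, HasWeakDeriv D i u g then h.choose else 0

/-- `u ∈ H¹(D)`. -/
def MemH1 (D : Set Pt) (u : Pt → ℝ) : Prop :=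
  MemLp u 2 (volume.restrict D) ∧ ∀ i, ∃ g, HasWeakDeriv D i u g

/-- `u ∈ H²(D)`. -/
def MemH2 (D : Set Pt) (u : Pt → ℝ) : Prop :=
  MemH1 D u ∧ ∀ i, MemH1 D (weakD D i u)

/-- The norm of `H¹(D)`. -/
def normH1 (D : Set Pt) (u : Pt → ℝ) : ℝ :=
  Real.sqrt ((∫ x in D, u x ^ 2) + ∑ i, ∫ x in D, weakD D i u x ^ 2)

/-- The norm of `H²(D)`, with the Frobenius norm of the Hessian. -/
def normH2 (D : Set Pt) (u : Pt → ℝ) : ℝ :=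
  Real.sqrt ((∫ x in D, u x ^ 2) + (∑ i, ∫ x in D, weakD D i u x ^ 2)
    + ∑ i, ∑ j, ∫ x in D, weakD D j (weakD D i u) x ^ 2)

/-- `u ∈ H¹₀(D)`: the closure of the test functions in `H¹(D)`. -/
def MemH10 (D : Set Pt) (u : Pt → ℝ) : Prop :=
  MemH1 D u ∧ ∀ η : ℝ, 0 < η → ∃ φ, IsTest D φ ∧ normH1 D (fun x => u x - φ x) < η

/-- `W = H²(Ω) ∩ H¹₀(Ω)`. -/
def MemW (Ω : Set Pt) (u : Pt → ℝ) : Prop := MemH2 Ω u ∧ MemH10 Ω u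

/-- The weak Hessian, `(i, j) ↦ ∂²u/∂x_i∂x_j`. -/
def hess (D : Set Pt) (u : Pt → ℝ) (x : Pt) : Matrix (Fin 2) (Fin 2) ℝ :=
  Matrix.of fun i j => weakD D j (weakD D i u) x

/-- The weak Laplacian. -/
def lap (D : Set Pt) (u : Pt → ℝ) (x : Pt) : ℝ := ∑ i, weakD D i (weakD D i u) x

/-- The cofactor matrix `cof (D²u)` on `D`. -/
def cofHess (D : Set Pt) (u : Pt → ℝ) (x : Pt) : Matrix (Fin 2) (Fin 2) ℝ :=
  (hess D u x).adjugateᵀ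

/-- The `L^∞(D)` norm of a matrix field, with the Frobenius norm of matrices. -/
def supNorm (D : Set Pt) (Φ : Pt → Matrix (Fin 2) (Fin 2) ℝ) : ℝ :=
  (eLpNorm (fun x => Real.sqrt (∑ i, ∑ j, Φ x i j ^ 2)) ⊤ (volume.restrict D)).toReal

/-- `f` has the boundary value (trace) `c` at the point `x` of the closure of the open set `D`: the
mean of `|f - c|` over `D ∩ B(x, r)` tends to `0` as `r → 0`. On a Lipschitz domain every function
in `H¹(D)` has its trace as boundary value in this sense at almost every boundary point. -/
def HasTraceAt (D : Set Pt) (f : Pt → ℝ) (x : Pt) (c : ℝ) : Prop :=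
  Tendsto (fun r : ℝ => ⨍⁻ y in D ∩ Metric.ball x r, ‖f y - c‖ₑ ∂volume) (𝓝[>] 0) (𝓝 0)

open Classical in
/-- The trace of `f` at `x` (`0` where there is none). -/
def traceAt (D : Set Pt) (f : Pt → ℝ) (x : Pt) : ℝ :=
  if h : ∃ c, HasTraceAt D f x c then h.choose else 0

/-- The trace on `∂D`, at the point `x`, of the derivative `∇v · n` of `v` in the direction `n`. -/
def normalDerivAt (D : Set Pt) (v : Pt → ℝ) (n x : Pt) : ℝ :=
  ∑ j, n j * traceAt D (weakD D j v) x

/-! ### Polygons and meshes -/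

/-- A simple polygon: the bounded open connected set `carrier` whose boundary is the simple closed
polygonal curve through the vertices, listed counter-clockwise. Indices are cyclic; angles of size
`π` (hanging nodes) are allowed. -/
structure Polygon where
  /-- The number of edges is `m + 3`. -/
  m : ℕ
  vertex : Fin (m + 3) → Pt
  carrier : Set Pt
  isOpen : IsOpen carrier
  isConnected : IsConnected carrier
  isBounded : Bornology.IsBounded carrier
  frontier_eq : frontier carrier = ⋃ i, segment ℝ (vertex i) (vertex (i + 1))
  vertex_injective : Function.Injective vertex
  edges_disjoint : ∀ i j, i ≠ j →
    Disjoint (openSegment ℝ (vertex i) (vertex (i + 1))) (segment ℝ (vertex j) (vertex (j + 1)))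
  /-- The interior lies to the left of every edge. -/
  counterclockwise : ∀ i, ∀ t ∈ Ioo (0 : ℝ) 1, ∀ᶠ s in 𝓝[>] (0 : ℝ),
    AffineMap.lineMap (vertex i) (vertex (i + 1)) t
      + s • !₂[-((vertex (i + 1) - vertex i) 1), (vertex (i + 1) - vertex i) 0] ∈ carrier

namespace Polygon

variable (K : Polygon)

/-- The index type of the vertices and of the edges; edge `i` joins vertex `i` to vertex `i+1`. -/
abbrev Idx := Fin (K.m + 3)

/-- The length `h_e` of an edge. -/
def len (i : K.Idx) : ℝ := dist (K.vertex i) (K.vertex (i + 1))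

/-- The point with parameter `t ∈ [0, 1]` on an edge. -/
def pt (i : K.Idx) (t : ℝ) : Pt := AffineMap.lineMap (K.vertex i) (K.vertex (i + 1)) t

/-- The counter-clockwise unit tangent on an edge. -/
def tangent (i : K.Idx) : Pt := (K.len i)⁻¹ • (K.vertex (i + 1) - K.vertex i)

/-- The outward unit normal on an edge. -/
def normal (i : K.Idx) : Pt := !₂[K.tangent i 1, -(K.tangent i 0)]

/-- The integral `∫_e f ds` over an edge of a function given in terms of the parameter `t`. -/
def edgeInt (i : K.Idx) (f : ℝ → ℝ) : ℝ := K.len i * ∫ t in (0 : ℝ)..1, f t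

/-- The element diameter `h_K`. -/
def diam : ℝ := Metric.diam K.carrier

/-- The outward normal derivative of `v` on an edge, as a function of the parameter `t`. -/
def normalDeriv (v : Pt → ℝ) (i : K.Idx) (t : ℝ) : ℝ :=
  normalDerivAt K.carrier v (K.normal i) (K.pt i t)

/-- `f` has a trace in `L²` on every edge. -/
def HasL2Trace (f : Pt → ℝ) : Prop :=
  ∀ i, (∀ᵐ t ∂volume.restrict (Ioo (0 : ℝ) 1), ∃ c, HasTraceAt K.carrier f (K.pt i t) c) ∧
    MemLp (fun t => traceAt K.carrier f (K.pt i t)) 2 (volume.restrict (Ioo (0 : ℝ) 1))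

end Polygon

/-- A subdivision of `Ω` into finitely many non-overlapping simple polygons. Two edges of elements
coincide (then they are traversed in opposite directions) or have disjoint relative interiors. -/
structure Mesh (Ω : Set Pt) (ι : Type) where
  elem : ι → Polygon
  subset : ∀ k, (elem k).carrier ⊆ Ω
  cover : closure Ω = ⋃ k, closure (elem k).carrier
  disjoint : ∀ k l, k ≠ l → Disjoint (elem k).carrier (elem l).carrier
  conforming : ∀ k l (i : (elem k).Idx) (j : (elem l).Idx), k ≠ l →
    Disjoint (openSegment ℝ ((elem k).vertex i) ((elem k).vertex (i + 1)))
        (openSegment ℝ ((elem l).vertex j) ((elem l).vertex (j + 1))) ∨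
      ((elem k).vertex i = (elem l).vertex (j + 1) ∧ (elem k).vertex (i + 1) = (elem l).vertex j)

/-- Edge `i` of element `k` and edge `j` of element `l` are the same interior edge. -/
def Mesh.Shared {Ω : Set Pt} {ι : Type} (M : Mesh Ω ι) (k l : ι)
    (i : (M.elem k).Idx) (j : (M.elem l).Idx) : Prop :=
  k ≠ l ∧ (M.elem k).vertex i = (M.elem l).vertex (j + 1) ∧
    (M.elem k).vertex (i + 1) = (M.elem l).vertex j

/-- Edge `i` of element `k` is a boundary edge. -/
def Mesh.IsBdry {Ω : Set Pt} {ι : Type} (M : Mesh Ω ι) (k : ι) (i : (M.elem k).Idx) : Prop :=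
  segment ℝ ((M.elem k).vertex i) ((M.elem k).vertex (i + 1)) ⊆ frontier Ω

open Classical in
/-- `∑_{e boundary edge} ∫_e f ds`, for a function `f` of the element, its edge and the parameter. -/
def Mesh.bdryInt {Ω : Set Pt} {ι : Type} [Fintype ι] (M : Mesh Ω ι)
    (f : (k : ι) → (M.elem k).Idx → ℝ → ℝ) : ℝ :=
  ∑ k, ∑ i, if M.IsBdry k i then (M.elem k).edgeInt i (f k i) else 0

/-- The broken `H²` norm `‖u‖_{2,h}` of a function given element by element. -/
def Mesh.norm {Ω : Set Pt} {ι : Type} [Fintype ι] (M : Mesh Ω ι) (u : ι → Pt → ℝ) : ℝ :=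
  Real.sqrt (∑ k, normH2 (M.elem k).carrier (u k) ^ 2)

/-! ### Polynomials

Polynomials on elements are bivariate polynomials; polynomials on an edge are univariate polynomials
in the parameter `t`, those of degree at most `d` forming `Polynomial.degreeLT ℝ (d + 1)`. -/

/-- The polynomials of degree at most `d`. -/
abbrev polyDeg (d : ℕ) : Submodule ℝ (MvPolynomial (Fin 2) ℝ) :=
  MvPolynomial.restrictTotalDegree (Fin 2) ℝ d

/-- The polynomials of degree at most `ℓ - 4` (only `0` if `ℓ < 4`). -/
abbrev polyLow (ℓ : ℕ) : Submodule ℝ (MvPolynomial (Fin 2) ℝ) :=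
  MvPolynomial.restrictSupport ℝ {m : Fin 2 →₀ ℕ | m.degree + 4 ≤ ℓ}

/-- The function defined by a polynomial. -/
def pval (p : MvPolynomial (Fin 2) ℝ) (x : Pt) : ℝ := MvPolynomial.eval (fun i => x i) p

/-- The polynomial `q` of degree at most `d` with `∫_K q r = F r` for all polynomials `r` of degree
at most `d`. -/
def polyRiesz (K : Polygon) (d : ℕ) (F : MvPolynomial (Fin 2) ℝ → ℝ) : MvPolynomial (Fin 2) ℝ :=
  Classical.epsilon fun q =>
    q ∈ polyDeg d ∧ ∀ r ∈ polyDeg d, ∫ x in K.carrier, pval q x * pval r x = F r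

/-! ### Local spaces, degrees of freedom, projections -/

/-- The enlarged local space: functions `v ∈ H²(K)` with `Δ²v ∈ P_ℓ(K)`, and `v|_e ∈ P_ℓ(e)`,
`Δv|_e ∈ P_{ℓ-2}(e)` on all edges. As `H²(K) ⊂ C(K̄)`, functions are represented by their
continuous representative. `Δ²v` is taken in the sense of distributions; `Δv|_e` is the continuous
extension of `Δv` to the relatively open edge. On a polygon the gradient of an `H²` function always
has an `L²` trace; this is recorded for definiteness. -/
def Enlarged (K : Polygon) (ℓ : ℕ) (v : Pt → ℝ) : Prop :=
  MemH2 K.carrier v ∧ ContinuousOn v (closure K.carrier) ∧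
  (∀ j, K.HasL2Trace (weakD K.carrier j v)) ∧
  (∃ q ∈ polyDeg ℓ, ∀ φ, IsTest K.carrier φ →
    ∫ x in K.carrier, lap K.carrier v x * ∑ i, pd i (pd i φ) x
      = ∫ x in K.carrier, pval q x * φ x) ∧
  (∀ i, ∃ r ∈ Polynomial.degreeLT ℝ (ℓ + 1), ∀ t ∈ Icc (0 : ℝ) 1, v (K.pt i t) = r.eval t) ∧
  (∃ z : Pt → ℝ, z =ᵐ[volume.restrict K.carrier] lap K.carrier v ∧
    ∀ i, ∃ r ∈ Polynomial.degreeLT ℝ (ℓ - 1), ∀ t ∈ Ioo (0 : ℝ) 1,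
      Tendsto z (𝓝[K.carrier] (K.pt i t)) (𝓝 (r.eval t)))

/-- The polynomial bases with which the degrees of freedom of an element are computed: bases of
`P_{ℓ-2}(e)` for the edge moments and for the normal moments, and a basis of `P_{ℓ-4}(K)`. -/
structure DofBasis (K : Polygon) (ℓ : ℕ) where
  edge : K.Idx → Module.Basis (Fin (ℓ - 1)) ℝ (Polynomial.degreeLT ℝ (ℓ - 1))
  normal : K.Idx → Module.Basis (Fin (ℓ - 1)) ℝ (Polynomial.degreeLT ℝ (ℓ - 1))
  inner : Module.Basis (Fin (Module.finrank ℝ (polyLow ℓ))) ℝ (polyLow ℓ)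

/-- The index set of the degrees of freedom `Λ^K`: vertex values, edge moments, normal moments,
interior moments. -/
abbrev DofIdx (K : Polygon) (ℓ : ℕ) : Type :=
  K.Idx ⊕ (K.Idx × Fin (ℓ - 1)) ⊕ (K.Idx × Fin (ℓ - 1)) ⊕
    Fin (Module.finrank ℝ (polyLow ℓ))

/-- The degrees of freedom `Λ^K(v)`. -/
def dof {K : Polygon} {ℓ : ℕ} (B : DofBasis K ℓ) (v : Pt → ℝ) : DofIdx K ℓ → ℝ
  | .inl i => v (K.vertex i)
  | .inr (.inl (i, a)) =>
      (K.len i)⁻¹ * K.edgeInt i fun t => v (K.pt i t) * (B.edge i a : Polynomial ℝ).eval t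
  | .inr (.inr (.inl (i, a))) =>
      K.edgeInt i fun t => K.normalDeriv v i t * (B.normal i a : Polynomial ℝ).eval t
  | .inr (.inr (.inr a)) =>
      (volume.real K.carrier)⁻¹ *
        ∫ x in K.carrier, v x * pval (B.inner a : MvPolynomial (Fin 2) ℝ) x

/-- A choice of the value projection, the edge projections and the normal projections of an element:
linear combinations of the degrees of freedom (in `normal`, normal derivatives are taken in the
direction outward to the element). -/
structure Proj {K : Polygon} {ℓ : ℕ} (B : DofBasis K ℓ) where
  value : (DofIdx K ℓ → ℝ) →ₗ[ℝ] MvPolynomial (Fin 2) ℝ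
  edge : K.Idx → (DofIdx K ℓ → ℝ) →ₗ[ℝ] Polynomial ℝ
  normal : K.Idx → (DofIdx K ℓ → ℝ) →ₗ[ℝ] Polynomial ℝ
  value_mem : ∀ d, value d ∈ polyDeg ℓ
  value_moment : ∀ v, Enlarged K ℓ v → ∀ p ∈ polyLow ℓ,
    ∫ x in K.carrier, pval (value (dof B v)) x * pval p x = ∫ x in K.carrier, v x * pval p x
  value_poly : ∀ q ∈ polyDeg ℓ, value (dof B (pval q)) = q
  edge_mem : ∀ i d, edge i d ∈ Polynomial.degreeLT ℝ (ℓ + 1)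
  edge_start : ∀ i v, Enlarged K ℓ v → (edge i (dof B v)).eval 0 = v (K.vertex i)
  edge_end : ∀ i v, Enlarged K ℓ v → (edge i (dof B v)).eval 1 = v (K.vertex (i + 1))
  edge_moment : ∀ i v, Enlarged K ℓ v → ∀ p ∈ Polynomial.degreeLT ℝ (ℓ - 1),
    K.edgeInt i (fun t => (edge i (dof B v)).eval t * p.eval t)
      = K.edgeInt i fun t => v (K.pt i t) * p.eval t
  edge_poly : ∀ i, ∀ q ∈ polyDeg ℓ, ∀ t, (edge i (dof B (pval q))).eval t = pval q (K.pt i t)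
  normal_mem : ∀ i d, normal i d ∈ Polynomial.degreeLT ℝ ℓ
  normal_moment : ∀ i v, Enlarged K ℓ v → ∀ p ∈ Polynomial.degreeLT ℝ (ℓ - 1),
    K.edgeInt i (fun t => (normal i (dof B v)).eval t * p.eval t)
      = K.edgeInt i fun t => K.normalDeriv v i t * p.eval t
  normal_poly : ∀ i, ∀ q ∈ polyDeg ℓ, ∀ t, (normal i (dof B (pval q))).eval t
    = ∑ j, K.normal i j * pval (MvPolynomial.pderiv j q) (K.pt i t)

namespace Proj

variable {K : Polygon} {ℓ : ℕ} {B : DofBasis K ℓ} (P : Proj B)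

/-- The value projection `Π v ∈ P_ℓ(K)`. -/
def val (v : Pt → ℝ) : MvPolynomial (Fin 2) ℝ := P.value (dof B v)

/-- Component `i` of the gradient projection of `v`, in `P_{ℓ-1}(K)`; the test fields are
`r e_i`. -/
def grad (v : Pt → ℝ) (i : Fin 2) : MvPolynomial (Fin 2) ℝ :=
  polyRiesz K (ℓ - 1) fun r =>
    -(∫ x in K.carrier, pval (P.val v) x * pval (MvPolynomial.pderiv i r) x)
      + ∑ e, K.edgeInt e fun t =>
          (P.edge e (dof B v)).eval t * (pval r (K.pt e t) * K.normal e i)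

/-- Component `(i, j)` of the Hessian projection of `v`, in `P_{ℓ-2}(K)`; the test fields are
`r e_i ⊗ e_j`. The derivative along the edge is the derivative with respect to arc length. -/
def hess (v : Pt → ℝ) (i j : Fin 2) : MvPolynomial (Fin 2) ℝ :=
  polyRiesz K (ℓ - 2) fun r =>
    -(∫ x in K.carrier, pval (P.grad v i) x * pval (MvPolynomial.pderiv j r) x)
      + ∑ e, K.edgeInt e fun t =>
          ((P.normal e (dof B v)).eval t * (K.normal e i * K.normal e j)
            + (K.len e)⁻¹ * (P.edge e (dof B v)).derivative.eval t
              * (K.tangent e i * K.normal e j)) * pval r (K.pt e t)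

/-- The local virtual element space. -/
def Local (v : Pt → ℝ) : Prop :=
  Enlarged K ℓ v ∧ ∀ p ∈ polyDeg ℓ, p ∉ polyLow ℓ →
    ∫ x in K.carrier, (v x - pval (P.val v) x) * pval p x = 0

end Proj

/-! ### Global space and bilinear forms -/

variable {Ω : Set Pt} {ι : Type} [Fintype ι] {ℓ : ℕ}

/-- The nonconforming space `H²(𝒯_h) ∩ H¹₀(Ω)` with
`∫_e [∂v/∂n_e] p ds = 0` for all `p ∈ P_{ℓ-2}(e)` on all interior edges. -/
def MemHnc (M : Mesh Ω ι) (ℓ : ℕ) (v : Pt → ℝ) : Prop :=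
  (∀ k, MemH2 (M.elem k).carrier v) ∧ MemH10 Ω v ∧
  ∀ k l i j, M.Shared k l i j → ∀ p ∈ Polynomial.degreeLT ℝ (ℓ - 1),
    (M.elem k).edgeInt i (fun t =>
      (normalDerivAt (M.elem k).carrier v ((M.elem k).normal i) ((M.elem k).pt i t)
        - normalDerivAt (M.elem l).carrier v ((M.elem k).normal i) ((M.elem k).pt i t))
          * p.eval t) = 0

/-- The global virtual element space with zero boundary values; its members are represented by
their continuous representative on the closure of `Ω`. -/
def Vh (M : Mesh Ω ι) {B : (k : ι) → DofBasis (M.elem k) ℓ} (P : (k : ι) → Proj (B k)) :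
    Set (Pt → ℝ) :=
  {v | MemHnc M ℓ v ∧ ContinuousOn v (closure Ω) ∧ ∀ k, (P k).Local v}

/-- The linearised form on the open set `D`:
`ε ∫_D D²u : D²w + ∫_D Φ ∇u · ∇w`. -/
def AL (ε : ℝ) (Φ : Pt → Matrix (Fin 2) (Fin 2) ℝ) (D : Set Pt) (u w : Pt → ℝ) : ℝ :=
  ε * (∫ x in D, ∑ i, ∑ j, VEM.hess D u x i j * VEM.hess D w x i j)
    + ∫ x in D, ∑ i, ∑ j, Φ x i j * weakD D j u x * weakD D i w x

/-- The dofi-dofi stabilisation. -/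
def stab (ε : ℝ) (Φ : Pt → Matrix (Fin 2) (Fin 2) ℝ) {K : Polygon} (B : DofBasis K ℓ)
    (u w : Pt → ℝ) : ℝ :=
  (ε * (K.diam ^ 2)⁻¹ + supNorm K.carrier Φ) * ∑ a, dof B u a * dof B w a

/-- The discrete linearised form on an element. -/
def ALh (ε : ℝ) (Φ : Pt → Matrix (Fin 2) (Fin 2) ℝ) {K : Polygon} {B : DofBasis K ℓ}
    (P : Proj B) (u w : Pt → ℝ) : ℝ :=
  ε * (∫ x in K.carrier, ∑ i, ∑ j, pval (P.hess u i j) x * pval (P.hess w i j) x)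
    + (∫ x in K.carrier, ∑ i, ∑ j, Φ x i j * pval (P.grad u j) x * pval (P.grad w i) x)
    + stab ε Φ B (fun x => u x - pval (P.val u) x) (fun x => w x - pval (P.val w) x)

/-- `v ∈ W` solves the linearised variational problem with data `φ`, `ψ`. -/
def IsLinearSol (ε : ℝ) (Φ : Pt → Matrix (Fin 2) (Fin 2) ℝ) (M : Mesh Ω ι) (φ ψ v : Pt → ℝ) :
    Prop :=
  MemW Ω v ∧ ∀ w, MemW Ω w →
    AL ε Φ Ω v w = (∫ x in Ω, φ x * w x)
      + ε * M.bdryInt fun k i t => ψ ((M.elem k).pt i t) * (M.elem k).normalDeriv w i t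

/-- `vh` solves the linearised virtual element problem with data `φ`, `ψ`. -/
def IsDiscreteSol (ε : ℝ) (Φ : Pt → Matrix (Fin 2) (Fin 2) ℝ) (M : Mesh Ω ι)
    {B : (k : ι) → DofBasis (M.elem k) ℓ} (P : (k : ι) → Proj (B k)) (φ ψ vh : Pt → ℝ) : Prop :=
  vh ∈ Vh M P ∧ ∀ w ∈ Vh M P,
    ∑ k, ALh ε Φ (P k) vh w = (∫ x in Ω, φ x * w x)
      + ε * M.bdryInt fun k i t =>
          ψ ((M.elem k).pt i t) * ((P k).normal i (dof (B k) w)).eval t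

/-- The nonconformity error `E(v, δ)`. -/
def nonconfError (ε : ℝ) (Φ : Pt → Matrix (Fin 2) (Fin 2) ℝ) (M : Mesh Ω ι)
    (φ ψ v δ : Pt → ℝ) : ℝ :=
  (∫ x in Ω, φ x * δ x) - (∑ k, AL ε Φ (M.elem k).carrier v δ)
    + ε * M.bdryInt fun k i t => ψ ((M.elem k).pt i t) * (M.elem k).normalDeriv δ i t

/-- The dual norm `sup_{δ ∈ V_h, δ ≠ 0} |F δ| / ‖δ‖_{2,h}` over the discrete space, in `[0, ∞]`. -/
def dualNorm (M : Mesh Ω ι) {B : (k : ι) → DofBasis (M.elem k) ℓ} (P : (k : ι) → Proj (B k))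
    (F : (Pt → ℝ) → ℝ) : ℝ≥0∞ :=
  ⨆ δ ∈ Vh M P, ⨆ _ : M.norm (fun _ => δ) ≠ 0, ENNReal.ofReal (|F δ| / M.norm fun _ => δ)

end VEM

end

open VEM

noncomputable section

namespace VEM

/-! ### Test functions -/

/-! The argument is Strang's second lemma with inexact forms. Fix `w` in the discrete space and a
piecewise polynomial `p`, and put `δ = vh - w`. Coercivity on the discrete space and the lower
stability bound control `C₃ αlow ‖δ‖²` by the sum over the elements of `ALh(δ, δ)`. On each element,
bilinearity gives `ALh(δ, δ) = [ALh(vh, δ) - AL(v, δ)] + [AL(p, δ) - ALh(p, δ)] + AL(v - p, δ) -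
ALh(w - p, δ)`. By the discrete equation, the first bracket sums to the nonconformity error plus the
error made in the boundary data; the second is the consistency error. The third term is bounded by
`C₂`. The last is bounded by Cauchy-Schwarz for the semidefinite form `ALh` (`ALh_sq_le`) and the
upper stability bound, which applies because `w - p` lies in the local space. Dividing by `‖δ‖` and
using the triangle inequality through `v` gives the estimate, with the constants adding up as
stated.

The real work is to justify the bilinear algebra. Weak derivatives, traces and projections are
chosen objects, so each is linear only after a uniqueness statement: `HasWeakDeriv.ae_unique`,
`HasTraceAt.unique` and `eq_of_integral_pval_mul_eq`. From these follow linearity of the degrees of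
freedom (`dof_lin`), of the projections (`Proj.grad_lin`, `Proj.hess_lin`) and of the forms
(`AL_lin`, `ALh_lin`). Two structural facts complete the picture: polynomials lie in the local space
(`Proj.local_pval`), and the global space is closed under subtraction (`sub_mem_Vh`). -/

theorem continuous_pd {φ : Pt → ℝ} (hφ : ContDiff ℝ ∞ φ) (i : Fin 2) : Continuous (pd i φ) :=
  (hφ.continuous_fderiv (by simp)).clm_apply continuous_const

theorem IsTest.memLp {D : Set Pt} {φ : Pt → ℝ} (h : IsTest D φ) (p : ℝ≥0∞) (μ : Measure Pt)
    [IsFiniteMeasureOnCompacts μ] : MemLp φ p μ :=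
  h.1.continuous.memLp_of_hasCompactSupport h.2.1

theorem IsTest.pd {D : Set Pt} {φ : Pt → ℝ} (h : IsTest D φ) (i : Fin 2) :
    IsTest D (VEM.pd i φ) := by
  refine ⟨(h.1.fderiv_right (m := ∞) (by simp)).clm_apply contDiff_const, ?_, ?_⟩
  · exact h.2.1.fderiv_apply ℝ _
  · exact (tsupport_fderiv_apply_subset ℝ _).trans h.2.2

theorem IsTest.mono {D D' : Set Pt} {φ : Pt → ℝ} (h : IsTest D φ) (hD : D ⊆ D') : IsTest D' φ :=
  ⟨h.1, h.2.1, h.2.2.trans hD⟩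

theorem IsTest.lin {D : Set Pt} {φ χ : Pt → ℝ} (hφ : IsTest D φ) (hχ : IsTest D χ) (a b : ℝ) :
    IsTest D (a • φ + b • χ) := by
  refine ⟨(hφ.1.const_smul a).add (hχ.1.const_smul b), ?_, ?_⟩
  · exact (hφ.2.1.smul_left (f := fun _ => a)).add (hχ.2.1.smul_left (f := fun _ => b))
  · refine (tsupport_add _ _).trans (union_subset ?_ ?_)
    · exact (tsupport_smul_subset_right (fun _ => a) φ).trans hφ.2.2
    · exact (tsupport_smul_subset_right (fun _ => b) χ).trans hχ.2.2

theorem IsTest.eq_zero_of_notMem {D : Set Pt} {φ : Pt → ℝ} (h : IsTest D φ) {x : Pt}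
    (hx : x ∉ D) : φ x = 0 :=
  image_eq_zero_of_notMem_tsupport fun h' => hx (h.2.2 h')

theorem pd_comm {φ : Pt → ℝ} (hφ : ContDiff ℝ ∞ φ) (i j : Fin 2) :
    pd i (pd j φ) = pd j (pd i φ) := by
  have key : ∀ i j x, pd i (pd j φ) x
      = fderiv ℝ (fderiv ℝ φ) x (EuclideanSpace.single i 1) (EuclideanSpace.single j 1) := by
    intro i j x
    have hd : DifferentiableAt ℝ (fderiv ℝ φ) x :=
      ((hφ.fderiv_right (m := ∞) (by simp)).differentiable (by simp)) x
    have := (hd.hasFDerivAt.clm_apply (hasFDerivAt_const (EuclideanSpace.single j (1 : ℝ)) x)).fderiv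
    change fderiv ℝ (fun y => fderiv ℝ φ y (EuclideanSpace.single j 1)) x _ = _
    rw [this]; simp
  ext x
  rw [key, key]
  have h2 : minSmoothness ℝ 2 ≤ (∞ : WithTop ℕ∞) := by
    rw [minSmoothness_of_isRCLikeNormedField]; exact WithTop.coe_le_coe.2 le_top
  exact (hφ.contDiffAt.isSymmSndFDerivAt h2) _ _

/-! ### Square integrable functions -/

theorem memLp_lin {μ : Measure Pt} {p : ℝ≥0∞} {f g : Pt → ℝ} (hf : MemLp f p μ)
    (hg : MemLp g p μ) (a b : ℝ) : MemLp (a • f + b • g) p μ :=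
  (hf.const_smul a).add (hg.const_smul b)

theorem integral_lin_mul {α : Type*} [MeasurableSpace α] {μ : Measure α} {f g h : α → ℝ}
    (hf : Integrable (fun x => f x * h x) μ)
    (hg : Integrable (fun x => g x * h x) μ) (a b : ℝ) :
    ∫ x, (a • f + b • g) x * h x ∂μ = a * (∫ x, f x * h x ∂μ) + b * ∫ x, g x * h x ∂μ := by
  rw [← integral_const_mul, ← integral_const_mul, ← integral_add (hf.const_mul a) (hg.const_mul b)]
  congr 1; ext x; simp; ring

theorem norm_toLp_sq {α : Type*} [MeasurableSpace α] {μ : Measure α} {f : α → ℝ}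
    (hf : MemLp f 2 μ) : ‖hf.toLp f‖ ^ 2 = ∫ x, f x ^ 2 ∂μ := by
  rw [← real_inner_self_eq_norm_sq, L2.inner_def]
  refine integral_congr_ae ?_
  filter_upwards [hf.coeFn_toLp] with x hx
  simp [hx, sq]

/-- Minkowski's inequality for finite families of square integrable functions. -/
theorem sqrt_sum_integral_sq_lin_le {J α : Type*} [Fintype J] [MeasurableSpace α]
    {μ : J → Measure α} {f g : J → α → ℝ} (hf : ∀ j, MemLp (f j) 2 (μ j))
    (hg : ∀ j, MemLp (g j) 2 (μ j)) (a b : ℝ) :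
    Real.sqrt (∑ j, ∫ x, (a * f j x + b * g j x) ^ 2 ∂μ j)
      ≤ |a| * Real.sqrt (∑ j, ∫ x, f j x ^ 2 ∂μ j) + |b| * Real.sqrt (∑ j, ∫ x, g j x ^ 2 ∂μ j) := by
  -- The bound is the triangle inequality in the Hilbert sum of the spaces `L²(μ j)`.
  let F : PiLp 2 fun j => Lp ℝ 2 (μ j) := WithLp.toLp 2 fun j => (hf j).toLp (f j)
  let G : PiLp 2 fun j => Lp ℝ 2 (μ j) := WithLp.toLp 2 fun j => (hg j).toLp (g j)
  have hF : ‖F‖ = Real.sqrt (∑ j, ∫ x, f j x ^ 2 ∂μ j) := by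
    rw [PiLp.norm_eq_of_L2]; simp only [F, norm_toLp_sq]
  have hG : ‖G‖ = Real.sqrt (∑ j, ∫ x, g j x ^ 2 ∂μ j) := by
    rw [PiLp.norm_eq_of_L2]; simp only [G, norm_toLp_sq]
  have hFG : ‖a • F + b • G‖ = Real.sqrt (∑ j, ∫ x, (a * f j x + b * g j x) ^ 2 ∂μ j) := by
    rw [PiLp.norm_eq_of_L2]
    congr 1
    refine Finset.sum_congr rfl fun j _ => ?_
    have h : (a • F + b • G) j
        = (((hf j).const_smul a).add ((hg j).const_smul b)).toLp _ := by
      rfl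
    rw [h, norm_toLp_sq]; rfl
  rw [← hFG, ← hF, ← hG]
  exact (norm_add_le _ _).trans (by simp [norm_smul])

/-! ### Weak derivatives -/

section WeakDeriv

variable {D D' : Set Pt} {i j : Fin 2} {u w g g' : Pt → ℝ}

theorem IsTest.setIntegral_eq {φ : Pt → ℝ} (hφ : IsTest D φ) (f : Pt → ℝ) :
    ∫ x in D, f x * φ x = ∫ x, f x * φ x :=
  setIntegral_eq_integral_of_forall_compl_eq_zero fun x hx => by
    rw [hφ.eq_zero_of_notMem hx, mul_zero]

/-- The fundamental lemma of the calculus of variations, applied to `g - g'`. It makes the chosen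
derivative `weakD` computable: any weak derivative that can be exhibited equals it almost
everywhere. -/
theorem HasWeakDeriv.ae_unique (hD : IsOpen D) (h : HasWeakDeriv D i u g)
    (h' : HasWeakDeriv D i u g') : g =ᵐ[volume.restrict D] g' := by
  have hl : LocallyIntegrableOn (g - g') D volume :=
    locallyIntegrableOn_of_locallyIntegrable_restrict
      ((h.1.sub h'.1).locallyIntegrable one_le_two)
  have := hD.ae_eq_zero_of_integral_contDiff_smul_eq_zero hl fun φ h1 h2 h3 => ?_
  · rw [Filter.EventuallyEq, ae_restrict_iff' hD.measurableSet]
    filter_upwards [this] with x hx hxD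
    exact sub_eq_zero.1 (hx hxD)
  · have hφ : IsTest D φ := ⟨h1, h2, h3⟩
    have e : ∫ x in D, (g x - g' x) * φ x = 0 := by
      simp only [sub_mul]
      have := integral_sub (h.1.integrable_mul (hφ.memLp 2 _)) (h'.1.integrable_mul (hφ.memLp 2 _))
      refine this.trans ?_
      exact sub_eq_zero.2 (neg_injective ((h.2 φ hφ).symm.trans (h'.2 φ hφ)))
    rw [hφ.setIntegral_eq] at e
    rw [← e]; congr 1; ext x; simp [mul_comm]

theorem HasWeakDeriv.congr (h : HasWeakDeriv D i u g) (hu : u =ᵐ[volume.restrict D] w)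
    (hg : g =ᵐ[volume.restrict D] g') : HasWeakDeriv D i w g' := by
  refine ⟨(memLp_congr_ae hg).1 h.1, fun φ hφ => ?_⟩
  have h1 := integral_congr_ae (hu.mul (ae_eq_refl (pd i φ)))
  have h2 := integral_congr_ae (hg.mul (ae_eq_refl φ))
  exact h1.symm.trans ((h.2 φ hφ).trans (congrArg _ h2))

theorem HasWeakDeriv.lin (hu : MemLp u 2 (volume.restrict D)) (hw : MemLp w 2 (volume.restrict D))
    (h : HasWeakDeriv D i u g) (h' : HasWeakDeriv D i w g') (a b : ℝ) :
    HasWeakDeriv D i (a • u + b • w) (a • g + b • g') := by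
  refine ⟨memLp_lin h.1 h'.1 a b, fun φ hφ => ?_⟩
  have hp := (hφ.pd i).memLp 2 (volume.restrict D)
  have hp' := hφ.memLp 2 (volume.restrict D)
  rw [integral_lin_mul (hu.integrable_mul hp) (hw.integrable_mul hp),
    integral_lin_mul (h.1.integrable_mul hp') (h'.1.integrable_mul hp'), h.2 φ hφ, h'.2 φ hφ]
  ring

/-- A test function on the smaller set is one on the larger set and vanishes off its support, so
both identities are the same identity over the whole plane. -/
theorem HasWeakDeriv.mono (h : HasWeakDeriv D i u g) (hD : D' ⊆ D) : HasWeakDeriv D' i u g := by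
  refine ⟨h.1.mono_measure (Measure.restrict_mono_set _ hD), fun φ hφ => ?_⟩
  have := h.2 φ (hφ.mono hD)
  rwa [((hφ.mono hD).pd i).setIntegral_eq, (hφ.mono hD).setIntegral_eq,
    ← (hφ.pd i).setIntegral_eq, ← hφ.setIntegral_eq] at this

theorem hasWeakDeriv_weakD (h : ∃ g, HasWeakDeriv D i u g) : HasWeakDeriv D i u (weakD D i u) := by
  rw [weakD, dif_pos h]; exact h.choose_spec

theorem HasWeakDeriv.weakD_ae_eq (hD : IsOpen D) (h : HasWeakDeriv D i u g) :
    weakD D i u =ᵐ[volume.restrict D] g :=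
  (hasWeakDeriv_weakD ⟨g, h⟩).ae_unique hD h

theorem MemH1.hasWeakDeriv (h : MemH1 D u) (i : Fin 2) : HasWeakDeriv D i u (weakD D i u) :=
  hasWeakDeriv_weakD (h.2 i)

theorem MemH1.memLp_weakD (h : MemH1 D u) (i : Fin 2) :
    MemLp (weakD D i u) 2 (volume.restrict D) := (h.hasWeakDeriv i).1

theorem MemH1.congr (h : MemH1 D u) (hu : u =ᵐ[volume.restrict D] w) : MemH1 D w :=
  ⟨(memLp_congr_ae hu).1 h.1, fun i => ⟨_, (h.hasWeakDeriv i).congr hu (ae_eq_refl _)⟩⟩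

theorem MemH1.weakD_congr (hD : IsOpen D) (h : MemH1 D u) (hu : u =ᵐ[volume.restrict D] w)
    (i : Fin 2) : weakD D i w =ᵐ[volume.restrict D] weakD D i u :=
  ((h.hasWeakDeriv i).congr hu (ae_eq_refl _)).weakD_ae_eq hD

theorem MemH1.lin (h : MemH1 D u) (h' : MemH1 D w) (a b : ℝ) : MemH1 D (a • u + b • w) :=
  ⟨memLp_lin h.1 h'.1 a b, fun i => ⟨_, (h.hasWeakDeriv i).lin h.1 h'.1 (h'.hasWeakDeriv i) a b⟩⟩

theorem MemH1.weakD_lin (hD : IsOpen D) (h : MemH1 D u) (h' : MemH1 D w) (a b : ℝ) (i : Fin 2) :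
    weakD D i (a • u + b • w) =ᵐ[volume.restrict D] a • weakD D i u + b • weakD D i w :=
  ((h.hasWeakDeriv i).lin h.1 h'.1 (h'.hasWeakDeriv i) a b).weakD_ae_eq hD

theorem MemH1.mono (h : MemH1 D u) (hD : D' ⊆ D) : MemH1 D' u :=
  ⟨h.1.mono_measure (Measure.restrict_mono_set _ hD),
    fun i => ⟨_, (h.hasWeakDeriv i).mono hD⟩⟩

theorem MemH1.weakD_mono (hD' : IsOpen D') (h : MemH1 D u) (hD : D' ⊆ D) (i : Fin 2) :
    weakD D' i u =ᵐ[volume.restrict D'] weakD D i u :=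
  ((h.hasWeakDeriv i).mono hD).weakD_ae_eq hD'

theorem MemH2.memLp_weakD₂ (h : MemH2 D u) (i j : Fin 2) :
    MemLp (weakD D j (weakD D i u)) 2 (volume.restrict D) := (h.2 i).memLp_weakD j

theorem MemH2.lin (hD : IsOpen D) (h : MemH2 D u) (h' : MemH2 D w) (a b : ℝ) :
    MemH2 D (a • u + b • w) :=
  ⟨h.1.lin h'.1 a b, fun i => ((h.2 i).lin (h'.2 i) a b).congr (h.1.weakD_lin hD h'.1 a b i).symm⟩

/-- The inner derivative is known only up to a null set, so it must first be replaced inside the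
outer one by `MemH1.weakD_congr`; only then does first-order linearity apply. -/
theorem MemH2.weakD₂_lin (hD : IsOpen D) (h : MemH2 D u) (h' : MemH2 D w) (a b : ℝ)
    (i j : Fin 2) : weakD D j (weakD D i (a • u + b • w)) =ᵐ[volume.restrict D]
      a • weakD D j (weakD D i u) + b • weakD D j (weakD D i w) :=
  (((h.2 i).lin (h'.2 i) a b).weakD_congr hD (h.1.weakD_lin hD h'.1 a b i).symm j).trans
    ((h.2 i).weakD_lin hD (h'.2 i) a b j)

theorem MemH2.mono (hD' : IsOpen D') (h : MemH2 D u) (hD : D' ⊆ D) : MemH2 D' u :=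
  ⟨h.1.mono hD, fun i => ((h.2 i).mono hD).congr (h.1.weakD_mono hD' hD i).symm⟩

/-- Both derivatives are moved to the test function, where they commute classically. This is what
makes the cofactor matrix, and hence the discrete form, symmetric. -/
theorem MemH2.weakD₂_comm (hD : IsOpen D) (h : MemH2 D u) (i j : Fin 2) :
    weakD D j (weakD D i u) =ᵐ[volume.restrict D] weakD D i (weakD D j u) := by
  refine HasWeakDeriv.ae_unique hD (i := j) ((h.2 i).hasWeakDeriv j)
    ⟨h.memLp_weakD₂ j i, fun φ hφ => ?_⟩
  have h1 := (h.1.hasWeakDeriv i).2 _ (hφ.pd j)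
  have h2 := (h.1.hasWeakDeriv j).2 _ (hφ.pd i)
  have h3 := ((h.2 j).hasWeakDeriv i).2 _ hφ
  rw [pd_comm hφ.1] at h1
  linarith

theorem normH2_nonneg : 0 ≤ normH2 D u := Real.sqrt_nonneg _

theorem normH1_lin_le (hD : IsOpen D) (h : MemH1 D u) (h' : MemH1 D w) (a b : ℝ) :
    normH1 D (a • u + b • w) ≤ |a| * normH1 D u + |b| * normH1 D w := by
  have e : ∀ v : Pt → ℝ, normH1 D v = Real.sqrt (∑ o : Option (Fin 2),
      ∫ x in D, (o.elim v fun i => weakD D i v) x ^ 2) := by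
    intro v; simp [normH1, Fintype.sum_option]
  rw [e u, e w]
  refine le_trans (le_of_eq ?_) (sqrt_sum_integral_sq_lin_le (μ := fun _ => volume.restrict D)
    (f := fun o : Option (Fin 2) => o.elim u fun i => weakD D i u)
    (g := fun o : Option (Fin 2) => o.elim w fun i => weakD D i w) ?_ ?_ a b)
  · rw [e]; congr 1; refine Finset.sum_congr rfl fun o _ => ?_
    rcases o with _ | i
    · rfl
    · exact integral_congr_ae ((h.weakD_lin hD h' a b i).fun_comp (· ^ 2))
  · rintro (_ | i); exacts [h.1, h.memLp_weakD i]
  · rintro (_ | i); exacts [h'.1, h'.memLp_weakD i]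

/-- The function, its first and its second weak derivatives. -/
def jet (D : Set Pt) (u : Pt → ℝ) : Option (Fin 2 ⊕ Fin 2 × Fin 2) → Pt → ℝ
  | none => u
  | some (.inl i) => weakD D i u
  | some (.inr (i, j)) => weakD D j (weakD D i u)

theorem MemH2.memLp_jet (h : MemH2 D u) (o) : MemLp (jet D u o) 2 (volume.restrict D) := by
  rcases o with _ | i | ⟨i, j⟩
  exacts [h.1.1, h.1.memLp_weakD i, h.memLp_weakD₂ i j]

theorem MemH2.jet_lin (hD : IsOpen D) (h : MemH2 D u) (h' : MemH2 D w) (a b : ℝ) (o) :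
    jet D (a • u + b • w) o =ᵐ[volume.restrict D] fun x => a * jet D u o x + b * jet D w o x := by
  rcases o with _ | i | ⟨i, j⟩
  exacts [ae_eq_refl _, h.1.weakD_lin hD h'.1 a b i, h.weakD₂_lin hD h' a b i j]

theorem normH2_sq : normH2 D u ^ 2 = ∑ o, ∫ x in D, jet D u o x ^ 2 := by
  rw [normH2, Real.sq_sqrt]
  · simp [Fintype.sum_option, Fintype.sum_prod_type, jet, add_assoc]
  · have : ∀ f : Pt → ℝ, 0 ≤ ∫ x in D, f x ^ 2 := fun f => integral_nonneg fun x => sq_nonneg _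
    have := this u
    positivity

end WeakDeriv

/-! ### Polynomial functions -/

section Polynomials

variable {D : Set Pt} {d : ℕ} {p q : MvPolynomial (Fin 2) ℝ}

theorem pval_lin (a b : ℝ) (p q : MvPolynomial (Fin 2) ℝ) :
    pval (a • p + b • q) = a • pval p + b • pval q := by
  ext x; simp [pval, MvPolynomial.smul_eval]

theorem hasFDerivAt_pval (p : MvPolynomial (Fin 2) ℝ) (x : Pt) :
    HasFDerivAt (pval p)
      (∑ i, pval (MvPolynomial.pderiv i p) x • EuclideanSpace.proj (𝕜 := ℝ) i) x := by
  induction p using MvPolynomial.induction_on with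
  | C a =>
    have : pval (MvPolynomial.C a) = fun _ => a := by ext; simp [pval]
    rw [this]; simpa [pval] using hasFDerivAt_const a x
  | add p q hp hq =>
    have : pval (p + q) = fun x => pval p x + pval q x := by ext; simp [pval]
    rw [this]
    refine (hp.add hq).congr_fderiv ?_
    simp only [← Finset.sum_add_distrib, ← add_smul, map_add, pval]
  | mul_X p n hp =>
    have : pval (p * MvPolynomial.X n) = fun x => pval p x * x n := by ext; simp [pval]
    rw [this]
    refine (hp.mul (EuclideanSpace.proj (𝕜 := ℝ) n).hasFDerivAt).congr_fderiv ?_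
    ext v
    fin_cases n <;> simp [pval, MvPolynomial.pderiv_X, Pi.single_apply] <;>
      ring

theorem contDiff_pval (p : MvPolynomial (Fin 2) ℝ) : ContDiff ℝ ∞ (pval p) := by
  induction p using MvPolynomial.induction_on with
  | C a =>
    have : pval (MvPolynomial.C a) = fun _ => a := by ext; simp [pval]
    rw [this]; exact contDiff_const
  | add p q hp hq =>
    have : pval (p + q) = fun x => pval p x + pval q x := by ext; simp [pval]
    rw [this]; exact hp.add hq
  | mul_X p n hp =>
    have : pval (p * MvPolynomial.X n) = fun x => pval p x * x n := by ext; simp [pval]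
    rw [this]; exact hp.mul (EuclideanSpace.proj (𝕜 := ℝ) n).contDiff

@[fun_prop]
theorem continuous_pval (p : MvPolynomial (Fin 2) ℝ) : Continuous (pval p) :=
  (contDiff_pval p).continuous

theorem pd_pval (p : MvPolynomial (Fin 2) ℝ) (i : Fin 2) :
    pd i (pval p) = pval (MvPolynomial.pderiv i p) := by
  ext x
  rw [pd, (hasFDerivAt_pval p x).fderiv]
  fin_cases i <;> simp

theorem memLp_of_isBounded (hb : Bornology.IsBounded D) {f : Pt → ℝ} (hf : Continuous f)
    (r : ℝ≥0∞) : MemLp f r (volume.restrict D) := by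
  have : IsFiniteMeasure (volume.restrict D) := ⟨by simpa using hb.measure_lt_top⟩
  obtain ⟨C, hC⟩ := hb.isCompact_closure.exists_bound_of_continuousOn hf.continuousOn
  refine MemLp.of_bound (hf.aestronglyMeasurable) C ?_
  have : ∀ᵐ x ∂volume.restrict (closure D), ‖f x‖ ≤ C :=
    (ae_restrict_iff' isClosed_closure.measurableSet).2 (Eventually.of_forall hC)
  exact ae_mono (Measure.restrict_mono_set _ subset_closure) this

theorem memLp_pval (hb : Bornology.IsBounded D) (p : MvPolynomial (Fin 2) ℝ) (r : ℝ≥0∞) :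
    MemLp (pval p) r (volume.restrict D) := memLp_of_isBounded hb (continuous_pval p) r

theorem integrable_pval_mul (hb : Bornology.IsBounded D) (p q : MvPolynomial (Fin 2) ℝ) :
    Integrable (fun x => pval p x * pval q x) (volume.restrict D) :=
  (memLp_pval hb p 2).integrable_mul (memLp_pval hb q 2)

/-- The set `D` has no regularity, so parts are integrated over the whole plane, where the compact
support of the test function supplies integrability. Boundedness of `D` serves only to put the
derivative in `L²`. -/
theorem hasWeakDeriv_pval (hb : Bornology.IsBounded D) (p : MvPolynomial (Fin 2) ℝ) (i : Fin 2) :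
    HasWeakDeriv D i (pval p) (pval (MvPolynomial.pderiv i p)) := by
  refine ⟨memLp_pval hb _ 2, fun φ hφ => ?_⟩
  rw [(hφ.pd i).setIntegral_eq, hφ.setIntegral_eq]
  have hc : ∀ {f g : Pt → ℝ}, Continuous f → Continuous g → HasCompactSupport g →
      Integrable (fun x => f x * g x) := fun hf hg hgc =>
    (hf.mul hg).integrable_of_hasCompactSupport hgc.mul_left
  have h := integral_mul_fderiv_eq_neg_fderiv_mul_of_integrable (μ := (volume : Measure Pt))
    (f := pval p) (g := φ) (v := EuclideanSpace.single i (1 : ℝ)) ?_ ?_ ?_ ?_ ?_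
  · rw [← pd_pval]; exact h
  · exact hc (continuous_pd (contDiff_pval p) i) hφ.1.continuous hφ.2.1
  · exact hc (continuous_pval p) (continuous_pd hφ.1 i) (hφ.pd i).2.1
  · exact hc (continuous_pval p) hφ.1.continuous hφ.2.1
  · exact fun x _ => (contDiff_pval p).differentiable (by simp) x
  · exact fun x _ => hφ.1.differentiable (by simp) x

theorem weakD_pval (hD : IsOpen D) (hb : Bornology.IsBounded D) (p : MvPolynomial (Fin 2) ℝ)
    (i : Fin 2) : weakD D i (pval p) =ᵐ[volume.restrict D] pval (MvPolynomial.pderiv i p) :=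
  (hasWeakDeriv_pval hb p i).weakD_ae_eq hD

theorem memH1_pval (hb : Bornology.IsBounded D) (p : MvPolynomial (Fin 2) ℝ) : MemH1 D (pval p) :=
  ⟨memLp_pval hb p 2, fun i => ⟨_, hasWeakDeriv_pval hb p i⟩⟩

theorem memH2_pval (hD : IsOpen D) (hb : Bornology.IsBounded D) (p : MvPolynomial (Fin 2) ℝ) :
    MemH2 D (pval p) :=
  ⟨memH1_pval hb p, fun i => (memH1_pval hb _).congr (weakD_pval hD hb p i).symm⟩

theorem weakD₂_pval (hD : IsOpen D) (hb : Bornology.IsBounded D) (p : MvPolynomial (Fin 2) ℝ)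
    (i j : Fin 2) : weakD D j (weakD D i (pval p)) =ᵐ[volume.restrict D]
      pval (MvPolynomial.pderiv j (MvPolynomial.pderiv i p)) :=
  ((memH1_pval hb _).weakD_congr hD (weakD_pval hD hb p i).symm j).trans (weakD_pval hD hb _ j)

/-- Each monomial of the derivative comes from one of degree higher by one. For `d = 0` there is
none, so the truncated subtraction is harmless. -/
theorem pderiv_mem_polyDeg (hp : p ∈ polyDeg d) (i : Fin 2) :
    MvPolynomial.pderiv i p ∈ polyDeg (d - 1) := by
  rw [polyDeg, MvPolynomial.mem_restrictTotalDegree, MvPolynomial.totalDegree,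
    Finset.sup_le_iff] at *
  intro m hm
  have hm' : m + Finsupp.single i 1 ∈ p.support := by
    rw [MvPolynomial.mem_support_iff] at *
    intro h
    exact hm (by rw [MvPolynomial.coeff_pderiv, h, zero_mul])
  have := hp _ hm'
  rw [Finsupp.sum_add_index' (fun _ => rfl) (fun _ _ _ => rfl), Finsupp.sum_single_index rfl] at this
  omega

theorem polyDeg_mono {d e : ℕ} (h : d ≤ e) : polyDeg d ≤ polyDeg e := fun p hp => by
  rw [polyDeg, MvPolynomial.mem_restrictTotalDegree] at *; omega

/-- An open set contains a box, that is, a product of infinite sets, and a polynomial vanishing on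
such a product is zero. -/
theorem eq_zero_of_pval_eqOn (hD : IsOpen D) (hn : D.Nonempty) (h : ∀ x ∈ D, pval p x = 0) :
    p = 0 := by
  obtain ⟨x, hx⟩ := hn
  have ho : IsOpen ((WithLp.toLp 2 : (Fin 2 → ℝ) → Pt) ⁻¹' D) :=
    hD.preimage (PiLp.continuous_toLp 2 _)
  obtain ⟨r, hr, hs⟩ := Metric.isOpen_iff.1 ho (fun i => x i) hx
  rw [ball_pi _ hr] at hs
  refine MvPolynomial.funext_set (fun i => Metric.ball (x i) r)
    (fun i => infinite_of_mem_nhds (x i) (Metric.ball_mem_nhds _ hr)) fun y hy => ?_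
  simpa [pval] using h _ (hs hy)

/-- Testing with `r = p - q` gives `∫ (p - q)² = 0`. Continuity upgrades almost everywhere to
everywhere on the open set. -/
theorem eq_of_integral_pval_mul_eq (hD : IsOpen D) (hn : D.Nonempty) (hb : Bornology.IsBounded D)
    (hp : p ∈ polyDeg d) (hq : q ∈ polyDeg d)
    (h : ∀ r ∈ polyDeg d, ∫ x in D, pval p x * pval r x = ∫ x in D, pval q x * pval r x) :
    p = q := by
  rw [← sub_eq_zero]
  refine eq_zero_of_pval_eqOn hD hn ?_
  have e : ∀ x, pval (p - q) x = pval p x - pval q x := fun x => by simp [pval]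
  have h0 : ∫ x in D, pval (p - q) x * pval (p - q) x = 0 := by
    have h1 := h (p - q) (sub_mem hp hq)
    rw [← sub_eq_zero, ← integral_sub (integrable_pval_mul hb _ _) (integrable_pval_mul hb _ _)]
      at h1
    rw [← h1]; congr 1; ext x; rw [e]; ring
  rw [setIntegral_eq_zero_iff_of_nonneg_ae (Eventually.of_forall fun x => mul_self_nonneg _)
    (integrable_pval_mul hb _ _)] at h0
  have h1 := Measure.eqOn_open_of_ae_eq (μ := (volume : Measure Pt)) h0 hD
    (((continuous_pval _).mul (continuous_pval _)).continuousOn) continuousOn_const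
  exact fun x hx => by simpa using h1 hx

/-- The restriction of a polynomial to the segment with the given end points. -/
def segPoly (a b : Pt) : MvPolynomial (Fin 2) ℝ →ₐ[ℝ] Polynomial ℝ :=
  MvPolynomial.aeval fun i => Polynomial.C (a i) + Polynomial.C (b i - a i) * Polynomial.X

theorem eval_segPoly (a b : Pt) (p : MvPolynomial (Fin 2) ℝ) (t : ℝ) :
    (segPoly a b p).eval t = pval p (AffineMap.lineMap a b t) := by
  induction p using MvPolynomial.induction_on with
  | C c => simp [segPoly, pval]
  | add p q hp hq => simp [pval] at *; rw [hp, hq]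
  | mul_X p n hp =>
    simp only [map_mul, Polynomial.eval_mul, hp, pval]
    simp [segPoly, AffineMap.lineMap_apply]
    left; ring

theorem segPoly_mem_degreeLT (a b : Pt) (hp : p ∈ polyDeg d) :
    segPoly a b p ∈ Polynomial.degreeLT ℝ (d + 1) := by
  rw [Polynomial.mem_degreeLT]
  rw [polyDeg, MvPolynomial.mem_restrictTotalDegree] at hp
  have h : (segPoly a b p).natDegree ≤ d * 1 := MvPolynomial.aeval_natDegree_le p hp _ fun i => by
    compute_degree
  exact (Polynomial.degree_le_natDegree).trans_lt (by exact_mod_cast Nat.lt_succ_of_le (by omega))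

end Polynomials

/-! ### Traces -/

section Trace

variable {D : Set Pt} {f g : Pt → ℝ} {x : Pt} {c c' : ℝ}

theorem HasTraceAt.congr (h : HasTraceAt D f x c) (hfg : f =ᵐ[volume.restrict D] g) :
    HasTraceAt D g x c := by
  refine Tendsto.congr (fun r => laverage_congr ?_) h
  filter_upwards [ae_mono (Measure.restrict_mono_set _ inter_subset_left) hfg] with y hy
  rw [hy]

/-- The means are compared through the pointwise triangle inequality. Measurability of one summand
suffices to split the upper integral. -/
theorem HasTraceAt.lin (hf : AEStronglyMeasurable f (volume.restrict D))
    (h : HasTraceAt D f x c) (h' : HasTraceAt D g x c')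
    (a b : ℝ) : HasTraceAt D (a • f + b • g) x (a * c + b * c') := by
  have hlim := (ENNReal.Tendsto.const_mul (a := ‖a‖ₑ) h (Or.inr enorm_ne_top)).add
    (ENNReal.Tendsto.const_mul (a := ‖b‖ₑ) h' (Or.inr enorm_ne_top))
  simp only [mul_zero, add_zero] at hlim
  refine tendsto_of_tendsto_of_tendsto_of_le_of_le tendsto_const_nhds hlim (fun _ => zero_le)
    fun r => ?_
  simp only [laverage_eq']
  set μ := (volume.restrict (D ∩ Metric.ball x r) univ)⁻¹ • volume.restrict (D ∩ Metric.ball x r)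
  have hm : AEStronglyMeasurable f μ := (hf.mono_set inter_subset_left).smul_measure _
  have hm' : AEMeasurable (fun y => ‖f y - c‖ₑ) μ := (hm.sub aestronglyMeasurable_const).enorm
  rw [← lintegral_const_mul' _ _ enorm_ne_top, ← lintegral_const_mul' _ _ enorm_ne_top,
    ← lintegral_add_left' (hm'.const_mul _)]
  refine lintegral_mono fun y => ?_
  rw [← enorm_mul, ← enorm_mul]
  refine le_trans (le_of_eq ?_) (enorm_add_le _ _)
  congr 1; simp; ring

theorem measure_inter_ball_ne_zero (hD : IsOpen D) (hx : x ∈ closure D) {r : ℝ} (hr : 0 < r) :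
    volume (D ∩ Metric.ball x r) ≠ 0 := by
  refine ((hD.inter Metric.isOpen_ball).measure_pos volume ?_).ne'
  obtain ⟨y, hy, hy'⟩ := Metric.mem_closure_iff.1 hx r hr
  exact ⟨y, hy, by rwa [Metric.mem_ball, dist_comm]⟩

theorem measure_inter_ball_ne_top {r : ℝ} : volume (D ∩ Metric.ball x r) ≠ ⊤ :=
  ((measure_mono inter_subset_right).trans_lt measure_ball_lt_top).ne

/-- By linearity the zero function `f - f` has trace `c - c'`. The mean of a constant is that
constant as soon as `D ∩ B(x, r)` has positive finite measure, which is where `x ∈ closure D`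
enters. -/
theorem HasTraceAt.unique (hD : IsOpen D) (hx : x ∈ closure D)
    (hf : AEStronglyMeasurable f (volume.restrict D)) (h : HasTraceAt D f x c)
    (h' : HasTraceAt D f x c') : c = c' := by
  have h0 := h.lin hf h' 1 (-1)
  have hz : ((1 : ℝ) • f + (-1 : ℝ) • f) = fun _ => 0 := by ext; simp
  rw [hz] at h0
  have h1 : Tendsto (fun _ : ℝ => ‖(0 : ℝ) - (1 * c + -1 * c')‖ₑ) (𝓝[>] (0 : ℝ)) (𝓝 0) := by
    refine h0.congr' ?_
    filter_upwards [self_mem_nhdsWithin] with r hr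
    exact setLAverage_const (measure_inter_ball_ne_zero hD hx hr) measure_inter_ball_ne_top _
  have h2 := tendsto_nhds_unique tendsto_const_nhds h1
  rw [enorm_eq_zero] at h2
  linarith

theorem HasTraceAt.traceAt_eq (hD : IsOpen D) (hx : x ∈ closure D)
    (hf : AEStronglyMeasurable f (volume.restrict D)) (h : HasTraceAt D f x c) :
    traceAt D f x = c := by
  have he : ∃ c, HasTraceAt D f x c := ⟨c, h⟩
  rw [traceAt, dif_pos he]
  exact he.choose_spec.unique hD hx hf h

theorem HasTraceAt.of_continuousAt (hD : IsOpen D) (hx : x ∈ closure D) (h : ContinuousAt f x) :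
    HasTraceAt D f x (f x) := by
  rw [HasTraceAt, ENNReal.tendsto_nhds_zero]
  intro η hη
  have hc : Tendsto (fun y => ‖f y - f x‖ₑ) (𝓝 x) (𝓝 0) := by
    have : ContinuousAt (fun y => ‖f y - f x‖ₑ) x := (h.sub continuousAt_const).enorm
    simpa [ContinuousAt] using this
  obtain ⟨r, hr, hs⟩ := Metric.eventually_nhds_iff_ball.1 (hc.eventually (Iic_mem_nhds hη))
  filter_upwards [Ioo_mem_nhdsGT hr] with s hs'
  rw [← setLAverage_const (measure_inter_ball_ne_zero hD hx hs'.1)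
    (measure_inter_ball_ne_top (D := D) (x := x) (r := s)) η]
  refine laverage_mono_ae ?_
  have : ∀ᵐ y ∂volume.restrict (Metric.ball x s), ‖f y - f x‖ₑ ≤ η :=
    (ae_restrict_iff' measurableSet_ball).2 (Eventually.of_forall fun y hy =>
      hs y (Metric.ball_subset_ball hs'.2.le hy))
  exact ae_mono (Measure.restrict_mono_set _ inter_subset_right) this

end Trace

/-! ### Integrals and traces on edges -/

namespace Polygon

variable (K : Polygon) {f g : ℝ → ℝ}

theorem continuous_pt (i : K.Idx) : Continuous (K.pt i) := AffineMap.lineMap_continuous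

theorem pt_mem_closure (i : K.Idx) {t : ℝ} (ht : t ∈ Icc (0 : ℝ) 1) :
    K.pt i t ∈ closure K.carrier := by
  refine frontier_subset_closure ?_
  rw [K.frontier_eq]
  refine mem_iUnion.2 ⟨i, ?_⟩
  rw [segment_eq_image_lineMap]
  exact ⟨t, ht, rfl⟩

theorem edgeInt_eq (i : K.Idx) (f : ℝ → ℝ) :
    K.edgeInt i f = K.len i * ∫ t in Ioo (0 : ℝ) 1, f t := by
  rw [edgeInt, intervalIntegral.integral_of_le zero_le_one, integral_Ioc_eq_integral_Ioo]

theorem edgeInt_lin (i : K.Idx) (hf : IntegrableOn f (Ioo 0 1)) (hg : IntegrableOn g (Ioo 0 1))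
    (a b : ℝ) :
    K.edgeInt i (fun t => a * f t + b * g t) = a * K.edgeInt i f + b * K.edgeInt i g := by
  simp only [edgeInt_eq]
  rw [integral_add (hf.const_mul a) (hg.const_mul b), integral_const_mul, integral_const_mul]
  ring

theorem edgeInt_congr (i : K.Idx) (h : f =ᵐ[volume.restrict (Ioo (0 : ℝ) 1)] g) :
    K.edgeInt i f = K.edgeInt i g := by
  rw [edgeInt_eq, edgeInt_eq, integral_congr_ae h]

end Polygon

theorem integrableOn_Ioo_of_continuous {f : ℝ → ℝ} (hf : Continuous f) :
    IntegrableOn f (Ioo 0 1) :=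
  (hf.continuousOn.integrableOn_Icc (a := 0) (b := 1)).mono_set Ioo_subset_Icc_self

theorem memLp_Ioo_of_continuous {f : ℝ → ℝ} (hf : Continuous f) :
    MemLp f 2 (volume.restrict (Ioo (0 : ℝ) 1)) :=
  (memLp_two_iff_integrable_sq hf.aestronglyMeasurable).2
    (integrableOn_Ioo_of_continuous (hf.pow 2))

theorem integrableOn_Ioo_mul_continuous {f g : ℝ → ℝ}
    (hf : MemLp f 2 (volume.restrict (Ioo (0 : ℝ) 1))) (hg : Continuous g) :
    IntegrableOn (fun t => f t * g t) (Ioo 0 1) :=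
  hf.integrable_mul (memLp_Ioo_of_continuous hg)

/-- Equality holds at every `x`, even where no trace exists: the two trace predicates are equal, so
the choices made from them are identical. -/
theorem traceAt_congr {D : Set Pt} {f g : Pt → ℝ} (h : f =ᵐ[volume.restrict D] g) (x : Pt) :
    traceAt D f x = traceAt D g x := by
  have : HasTraceAt D f x = HasTraceAt D g x := by
    ext c; exact ⟨fun h' => h'.congr h, fun h' => h'.congr h.symm⟩
  unfold traceAt
  generalize HasTraceAt D f x = P at this
  subst this
  rfl

theorem hasTraceAt_traceAt {D : Set Pt} {f : Pt → ℝ} {x : Pt} (h : ∃ c, HasTraceAt D f x c) :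
    HasTraceAt D f x (traceAt D f x) := by
  rw [traceAt, dif_pos h]; exact h.choose_spec

theorem traceAt_lin {D : Set Pt} {f g : Pt → ℝ} {x : Pt} (hD : IsOpen D) (hx : x ∈ closure D)
    (hf : AEStronglyMeasurable f (volume.restrict D))
    (hg : AEStronglyMeasurable g (volume.restrict D))
    (h : ∃ c, HasTraceAt D f x c) (h' : ∃ c, HasTraceAt D g x c) (a b : ℝ) :
    traceAt D (a • f + b • g) x = a * traceAt D f x + b * traceAt D g x :=
  ((hasTraceAt_traceAt h).lin hf (hasTraceAt_traceAt h') a b).traceAt_eq hD hx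
    ((hf.const_smul a).add (hg.const_smul b))

namespace Polygon

variable {K : Polygon} {f g u w : Pt → ℝ}

theorem HasL2Trace.congr (h : K.HasL2Trace f) (hfg : f =ᵐ[volume.restrict K.carrier] g) :
    K.HasL2Trace g := by
  intro i
  refine ⟨(h i).1.mono fun t ⟨c, hc⟩ => ⟨c, hc.congr hfg⟩, ?_⟩
  simp only [← traceAt_congr hfg]
  exact (h i).2

/-- Additivity can fail where a summand has no trace; such points form a null set on each edge. -/
theorem HasL2Trace.traceAt_lin (hf : AEStronglyMeasurable f (volume.restrict K.carrier))
    (hg : AEStronglyMeasurable g (volume.restrict K.carrier)) (h : K.HasL2Trace f)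
    (h' : K.HasL2Trace g) (a b : ℝ) (i : K.Idx) : ∀ᵐ t ∂volume.restrict (Ioo (0 : ℝ) 1),
      traceAt K.carrier (a • f + b • g) (K.pt i t)
        = a * traceAt K.carrier f (K.pt i t) + b * traceAt K.carrier g (K.pt i t) := by
  filter_upwards [(h i).1, (h' i).1, ae_restrict_mem measurableSet_Ioo] with t h1 h2 ht
  exact VEM.traceAt_lin K.isOpen (K.pt_mem_closure i (Ioo_subset_Icc_self ht)) hf hg h1 h2 a b

theorem HasL2Trace.lin (hf : AEStronglyMeasurable f (volume.restrict K.carrier))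
    (hg : AEStronglyMeasurable g (volume.restrict K.carrier)) (h : K.HasL2Trace f)
    (h' : K.HasL2Trace g) (a b : ℝ) : K.HasL2Trace (a • f + b • g) := by
  intro i
  refine ⟨?_, ?_⟩
  · filter_upwards [(h i).1, (h' i).1] with t ⟨c, hc⟩ ⟨c', hc'⟩
    exact ⟨_, hc.lin hf hc' a b⟩
  · refine (memLp_congr_ae (HasL2Trace.traceAt_lin hf hg h h' a b i)).2 ?_
    exact ((h i).2.const_mul a).add ((h' i).2.const_mul b)

theorem hasL2Trace_of_continuous (hf : Continuous f) : K.HasL2Trace f := by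
  have key : ∀ i, ∀ t ∈ Ioo (0 : ℝ) 1, HasTraceAt K.carrier f (K.pt i t) (f (K.pt i t)) :=
    fun i t ht => HasTraceAt.of_continuousAt K.isOpen
      (K.pt_mem_closure i (Ioo_subset_Icc_self ht)) hf.continuousAt
  intro i
  refine ⟨(ae_restrict_mem measurableSet_Ioo).mono fun t ht => ⟨_, key i t ht⟩, ?_⟩
  refine (memLp_congr_ae ?_).2 (memLp_Ioo_of_continuous (hf.comp (K.continuous_pt i)))
  filter_upwards [ae_restrict_mem measurableSet_Ioo] with t ht
  exact (key i t ht).traceAt_eq K.isOpen (K.pt_mem_closure i (Ioo_subset_Icc_self ht))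
    hf.aestronglyMeasurable

theorem memLp_normalDeriv (hu : ∀ j, K.HasL2Trace (weakD K.carrier j u)) (i : K.Idx) (n : Pt) :
    MemLp (fun t => normalDerivAt K.carrier u n (K.pt i t)) 2
      (volume.restrict (Ioo (0 : ℝ) 1)) :=
  memLp_finsetSum _ fun j _ => ((hu j i).2.const_mul (n j))

theorem normalDerivAt_lin (h : MemH1 K.carrier u) (h' : MemH1 K.carrier w)
    (hu : ∀ j, K.HasL2Trace (weakD K.carrier j u)) (hw : ∀ j, K.HasL2Trace (weakD K.carrier j w))
    (a b : ℝ) (i : K.Idx) (n : Pt) : ∀ᵐ t ∂volume.restrict (Ioo (0 : ℝ) 1),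
      normalDerivAt K.carrier (a • u + b • w) n (K.pt i t)
        = a * normalDerivAt K.carrier u n (K.pt i t)
          + b * normalDerivAt K.carrier w n (K.pt i t) := by
  have := fun j => HasL2Trace.traceAt_lin (h.memLp_weakD j).1 (h'.memLp_weakD j).1 (hu j) (hw j)
    a b i
  filter_upwards [this 0, this 1] with t h0 h1
  simp only [normalDerivAt, Fin.sum_univ_two,
    traceAt_congr (h.weakD_lin K.isOpen h' a b _), h0, h1]
  ring

end Polygon

/-! ### The polynomial representing a functional -/

section Riesz

variable (K : Polygon) (d : ℕ)

/-- The `L²` pairing on the finite-dimensional space of polynomials is nondegenerate, so it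
represents every linear functional. Linearity of `F` is needed for the `epsilon` choice to have a
witness. -/
theorem polyRiesz_spec {F : MvPolynomial (Fin 2) ℝ → ℝ}
    (hF : ∀ a b p q, F (a • p + b • q) = a * F p + b * F q) :
    polyRiesz K d F ∈ polyDeg d ∧ ∀ r ∈ polyDeg d,
      ∫ x in K.carrier, pval (polyRiesz K d F) x * pval r x = F r := by
  have hb := K.isBounded
  have hadd : ∀ p q : MvPolynomial (Fin 2) ℝ, pval (p + q) = (1 : ℝ) • pval p + (1 : ℝ) • pval q :=
    fun p q => by simpa using pval_lin 1 1 p q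
  have hsmul : ∀ (c : ℝ) (p : MvPolynomial (Fin 2) ℝ), pval (c • p) = c • pval p + (0 : ℝ) • pval p :=
    fun c p => by simpa using pval_lin c 0 p p
  let T : polyDeg d →ₗ[ℝ] Module.Dual ℝ (polyDeg d) := LinearMap.mk₂ ℝ
    (fun p r => ∫ x in K.carrier, pval (p : MvPolynomial (Fin 2) ℝ) x * pval r.1 x)
    (fun p q r => by
      rw [Submodule.coe_add, hadd,
        integral_lin_mul (integrable_pval_mul hb _ _) (integrable_pval_mul hb _ _)]; ring)
    (fun c p r => by
      rw [Submodule.coe_smul, hsmul,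
        integral_lin_mul (integrable_pval_mul hb _ _) (integrable_pval_mul hb _ _), smul_eq_mul]
      ring)
    (fun p q r => by
      simp only [mul_comm (pval p.1 _)]
      rw [Submodule.coe_add, hadd,
        integral_lin_mul (integrable_pval_mul hb _ _) (integrable_pval_mul hb _ _)]; ring)
    (fun c p r => by
      simp only [mul_comm (pval p.1 _)]
      rw [Submodule.coe_smul, hsmul,
        integral_lin_mul (integrable_pval_mul hb _ _) (integrable_pval_mul hb _ _), smul_eq_mul]
      ring)
  have hinj : Function.Injective T := by
    intro p q h
    refine Subtype.ext (eq_of_integral_pval_mul_eq K.isOpen K.isConnected.nonempty hb p.2 q.2 ?_)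
    exact fun r hr => LinearMap.congr_fun h ⟨r, hr⟩
  -- A finite-dimensional space and its dual have the same dimension.
  have hsurj := (LinearMap.injective_iff_surjective_of_finrank_eq_finrank
    (Subspace.dual_finrank_eq (K := ℝ) (V := polyDeg d)).symm).1 hinj
  let F' : Module.Dual ℝ (polyDeg d) :=
    { toFun := fun r => F r
      map_add' := fun p q => by simpa using hF 1 1 p q
      map_smul' := fun c p => by simpa using hF c 0 p p }
  obtain ⟨q, hq⟩ := hsurj F'
  have hex : ∃ q, q ∈ polyDeg d ∧ ∀ r ∈ polyDeg d, ∫ x in K.carrier, pval q x * pval r x = F r :=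
    ⟨q, q.2, fun r hr => LinearMap.congr_fun hq ⟨r, hr⟩⟩
  exact Classical.epsilon_spec hex

theorem polyRiesz_lin {F G : MvPolynomial (Fin 2) ℝ → ℝ}
    (hF : ∀ a b p q, F (a • p + b • q) = a * F p + b * F q)
    (hG : ∀ a b p q, G (a • p + b • q) = a * G p + b * G q) (a b : ℝ) :
    polyRiesz K d (fun r => a * F r + b * G r) = a • polyRiesz K d F + b • polyRiesz K d G := by
  have hb := K.isBounded
  have h1 := polyRiesz_spec K d hF
  have h2 := polyRiesz_spec K d hG
  have h3 := polyRiesz_spec K d (F := fun r => a * F r + b * G r) fun s t p q => by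
    rw [hF, hG]; ring
  refine eq_of_integral_pval_mul_eq K.isOpen K.isConnected.nonempty hb h3.1
    (add_mem (Submodule.smul_mem _ _ h1.1) (Submodule.smul_mem _ _ h2.1)) fun r hr => ?_
  rw [h3.2 r hr, pval_lin,
    integral_lin_mul (integrable_pval_mul hb _ _) (integrable_pval_mul hb _ _),
    h1.2 r hr, h2.2 r hr]

/-- The functional obtained by integrating by parts the product of `∂π/∂x_i` with a polynomial,
with the values `f` on the edges. -/
def partsFunctional (i : Fin 2) (π : MvPolynomial (Fin 2) ℝ) (f : K.Idx → ℝ → ℝ)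
    (r : MvPolynomial (Fin 2) ℝ) : ℝ :=
  -(∫ x in K.carrier, pval π x * pval (MvPolynomial.pderiv i r) x)
    + ∑ e, K.edgeInt e fun t => f e t * pval r (K.pt e t)

variable {K}

/-- Linearity in the test polynomial is what `polyRiesz_spec` demands; linearity in the data,
`partsFunctional_data_lin`, is what then makes the projections linear. -/
theorem partsFunctional_lin (i : Fin 2) (π : MvPolynomial (Fin 2) ℝ) {f : K.Idx → ℝ → ℝ}
    (hf : ∀ e, Continuous (f e)) (a b : ℝ) (p q : MvPolynomial (Fin 2) ℝ) :
    partsFunctional K i π f (a • p + b • q)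
      = a * partsFunctional K i π f p + b * partsFunctional K i π f q := by
  have hb := K.isBounded
  have h1 : ∀ e, K.edgeInt e (fun t => f e t * pval (a • p + b • q) (K.pt e t))
      = a * K.edgeInt e (fun t => f e t * pval p (K.pt e t))
        + b * K.edgeInt e (fun t => f e t * pval q (K.pt e t)) := by
    intro e
    have hc := fun r => integrableOn_Ioo_of_continuous
      ((hf e).mul ((continuous_pval r).comp (K.continuous_pt e)))
    refine Eq.trans ?_ (K.edgeInt_lin e (hc p) (hc q) a b)
    congr 1; ext t; rw [pval_lin]; simp; ring
  have h2 : ∫ x in K.carrier, pval π x * pval (MvPolynomial.pderiv i (a • p + b • q)) x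
      = a * (∫ x in K.carrier, pval π x * pval (MvPolynomial.pderiv i p) x)
        + b * ∫ x in K.carrier, pval π x * pval (MvPolynomial.pderiv i q) x := by
    simp only [mul_comm (pval π _), map_add, Derivation.map_smul]
    rw [pval_lin, integral_lin_mul (integrable_pval_mul hb _ _) (integrable_pval_mul hb _ _)]
  simp only [partsFunctional]
  rw [h2, Finset.sum_congr rfl fun e _ => h1 e, Finset.sum_add_distrib, ← Finset.mul_sum,
    ← Finset.mul_sum]
  ring

theorem partsFunctional_data_lin (i : Fin 2) (π ρ : MvPolynomial (Fin 2) ℝ) {f g : K.Idx → ℝ → ℝ}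
    (hf : ∀ e, Continuous (f e)) (hg : ∀ e, Continuous (g e)) (a b : ℝ)
    (r : MvPolynomial (Fin 2) ℝ) :
    partsFunctional K i (a • π + b • ρ) (a • f + b • g) r
      = a * partsFunctional K i π f r + b * partsFunctional K i ρ g r := by
  have hb := K.isBounded
  have h1 : ∀ e, K.edgeInt e (fun t => (a • f + b • g) e t * pval r (K.pt e t))
      = a * K.edgeInt e (fun t => f e t * pval r (K.pt e t))
        + b * K.edgeInt e (fun t => g e t * pval r (K.pt e t)) := by
    intro e
    have hc := (continuous_pval r).comp (K.continuous_pt e)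
    refine Eq.trans ?_ (K.edgeInt_lin e (integrableOn_Ioo_of_continuous ((hf e).mul hc))
      (integrableOn_Ioo_of_continuous ((hg e).mul hc)) a b)
    congr 1; ext t; simp; ring
  simp only [partsFunctional]
  rw [pval_lin, integral_lin_mul (integrable_pval_mul hb _ _) (integrable_pval_mul hb _ _),
    Finset.sum_congr rfl fun e _ => h1 e, Finset.sum_add_distrib, ← Finset.mul_sum,
    ← Finset.mul_sum]
  ring

end Riesz

/-! ### The enlarged local space -/

section Enlarged

variable {K : Polygon} {ℓ : ℕ} {u w : Pt → ℝ}

theorem lap_lin {D : Set Pt} (hD : IsOpen D) (h : MemH2 D u) (h' : MemH2 D w) (a b : ℝ) :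
    lap D (a • u + b • w) =ᵐ[volume.restrict D] a • lap D u + b • lap D w := by
  filter_upwards [h.weakD₂_lin hD h' a b 0 0, h.weakD₂_lin hD h' a b 1 1] with x h0 h1
  simp only [lap, Fin.sum_univ_two, h0, h1, Pi.add_apply, Pi.smul_apply, smul_eq_mul]
  ring

theorem MemH2.memLp_lap {D : Set Pt} (h : MemH2 D u) : MemLp (lap D u) 2 (volume.restrict D) :=
  memLp_finsetSum _ fun i _ => h.memLp_weakD₂ i i

theorem IsTest.memLp_lap {D : Set Pt} {φ : Pt → ℝ} (h : IsTest D φ) :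
    MemLp (fun x => ∑ i, VEM.pd i (VEM.pd i φ) x) 2 (volume.restrict D) :=
  memLp_finsetSum _ fun i _ => ((h.pd i).pd i).memLp 2 _

theorem Enlarged.memH2 (h : Enlarged K ℓ u) : MemH2 K.carrier u := h.1

theorem Enlarged.hasL2Trace (h : Enlarged K ℓ u) (j : Fin 2) :
    K.HasL2Trace (weakD K.carrier j u) := h.2.2.1 j

theorem Enlarged.lin (h : Enlarged K ℓ u) (h' : Enlarged K ℓ w) (a b : ℝ) :
    Enlarged K ℓ (a • u + b • w) := by
  obtain ⟨h1, h2, h3, ⟨q, hq, h4⟩, h5, z, hz, h6⟩ := h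
  obtain ⟨h1', h2', h3', ⟨q', hq', h4'⟩, h5', z', hz', h6'⟩ := h'
  refine ⟨h1.lin K.isOpen h1' a b, (h2.const_smul a).add (h2'.const_smul b), fun j => ?_,
    ⟨a • q + b • q', add_mem (Submodule.smul_mem _ _ hq) (Submodule.smul_mem _ _ hq'),
      fun φ hφ => ?_⟩, fun i => ?_, a • z + b • z', ?_, fun i => ?_⟩
  · exact (Polygon.HasL2Trace.lin (h1.1.memLp_weakD j).1 (h1'.1.memLp_weakD j).1 (h3 j) (h3' j)
      a b).congr (h1.1.weakD_lin K.isOpen h1'.1 a b j).symm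
  · have e := integral_congr_ae ((lap_lin K.isOpen h1 h1' a b).mul
      (ae_eq_refl fun x => ∑ i, pd i (pd i φ) x))
    refine e.trans ?_
    have hp := hφ.memLp 2 (volume.restrict K.carrier)
    rw [pval_lin, integral_lin_mul ((memLp_pval K.isBounded q 2).integrable_mul hp)
      ((memLp_pval K.isBounded q' 2).integrable_mul hp), ← h4 φ hφ, ← h4' φ hφ]
    exact integral_lin_mul (h1.memLp_lap.integrable_mul hφ.memLp_lap)
      (h1'.memLp_lap.integrable_mul hφ.memLp_lap) a b
  · obtain ⟨r, hr, e⟩ := h5 i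
    obtain ⟨r', hr', e'⟩ := h5' i
    refine ⟨a • r + b • r', add_mem (Submodule.smul_mem _ _ hr) (Submodule.smul_mem _ _ hr'),
      fun t ht => ?_⟩
    simp [e t ht, e' t ht]
  · refine EventuallyEq.trans ?_ (lap_lin K.isOpen h1 h1' a b).symm
    exact (hz.const_smul a).add (hz'.const_smul b)
  · obtain ⟨r, hr, e⟩ := h6 i
    obtain ⟨r', hr', e'⟩ := h6' i
    refine ⟨a • r + b • r', add_mem (Submodule.smul_mem _ _ hr) (Submodule.smul_mem _ _ hr'),
      fun t ht => ?_⟩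
    have := ((e t ht).const_mul a).add ((e' t ht).const_mul b)
    rwa [Polynomial.eval_add, Polynomial.eval_smul, Polynomial.eval_smul]

/-- Every condition holds classically: `Δp` and `Δ²p` are polynomials, and restrictions to edges are
obtained by substituting the affine parametrization. -/
theorem enlarged_pval (hℓ : 2 ≤ ℓ) {p : MvPolynomial (Fin 2) ℝ} (hp : p ∈ polyDeg ℓ) :
    Enlarged K ℓ (pval p) := by
  have hD := K.isOpen
  have hb := K.isBounded
  let L : MvPolynomial (Fin 2) ℝ → MvPolynomial (Fin 2) ℝ := fun p =>
    ∑ i, MvPolynomial.pderiv i (MvPolynomial.pderiv i p)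
  have hL : ∀ {p d}, p ∈ polyDeg d → L p ∈ polyDeg (d - 1 - 1) := fun hp =>
    sum_mem fun i _ => pderiv_mem_polyDeg (pderiv_mem_polyDeg hp i) i
  have pval_L : ∀ p x, pval (L p) x
      = ∑ i, pval (MvPolynomial.pderiv i (MvPolynomial.pderiv i p)) x := fun p x => by
    simp [L, pval]
  have hlap : lap K.carrier (pval p) =ᵐ[volume.restrict K.carrier] pval (L p) := by
    filter_upwards [weakD₂_pval hD hb p 0 0, weakD₂_pval hD hb p 1 1] with x h0 h1
    simp only [lap, pval_L, Fin.sum_univ_two, h0, h1]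
  refine ⟨memH2_pval hD hb p, (continuous_pval p).continuousOn, fun j => ?_,
    ⟨L (L p), polyDeg_mono (by omega) (hL (hL hp)), fun φ hφ => ?_⟩, fun i =>
      ⟨segPoly _ _ p, segPoly_mem_degreeLT _ _ hp, fun t _ => (eval_segPoly _ _ p t).symm⟩,
    pval (L p), hlap.symm, fun i => ⟨segPoly (K.vertex i) (K.vertex (i + 1)) (L p), ?_,
      fun t _ => ?_⟩⟩
  · exact (Polygon.hasL2Trace_of_continuous (continuous_pval _)).congr (weakD_pval hD hb p j).symm
  · refine (integral_congr_ae (hlap.mul (ae_eq_refl fun x => ∑ i, pd i (pd i φ) x))).trans ?_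
    have hi : ∀ (q : MvPolynomial (Fin 2) ℝ) {χ}, IsTest K.carrier χ →
        Integrable (fun x => pval q x * χ x) (volume.restrict K.carrier) := fun q χ hχ =>
      (memLp_pval hb q 2).integrable_mul (hχ.memLp 2 _)
    have hparts : ∀ i, ∫ x in K.carrier, pval (L p) x * pd i (pd i φ) x
        = ∫ x in K.carrier,
          pval (MvPolynomial.pderiv i (MvPolynomial.pderiv i (L p))) x * φ x := fun i => by
      rw [(hasWeakDeriv_pval hb (L p) i).2 _ (hφ.pd i),
        (hasWeakDeriv_pval hb _ i).2 _ hφ, neg_neg]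
    simp only [Pi.mul_apply, Finset.mul_sum, pval_L (L p), Finset.sum_mul]
    rw [integral_finsetSum _ fun i _ => hi _ ((hφ.pd i).pd i),
      integral_finsetSum _ fun i _ => hi _ hφ]
    exact Finset.sum_congr rfl fun i _ => hparts i
  · have := segPoly_mem_degreeLT (K.vertex i) (K.vertex (i + 1)) (hL hp)
    -- This is where `2 ≤ ℓ` matters: for `ℓ = 1` the truncated subtractions disagree.
    rwa [show ℓ - 1 - 1 + 1 = ℓ - 1 by omega] at this
  · rw [eval_segPoly]
    exact ((continuous_pval (L p)).tendsto _).mono_left nhdsWithin_le_nhds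

theorem Enlarged.memLp_edge (h : Enlarged K ℓ u) (i : K.Idx) :
    MemLp (fun t => u (K.pt i t)) 2 (volume.restrict (Ioo (0 : ℝ) 1)) := by
  obtain ⟨r, -, hr⟩ := h.2.2.2.2.1 i
  refine (memLp_congr_ae ?_).2 (memLp_Ioo_of_continuous r.continuous)
  filter_upwards [ae_restrict_mem measurableSet_Ioo] with t ht
  exact hr t (Ioo_subset_Icc_self ht)

theorem Enlarged.memLp_normalDeriv (h : Enlarged K ℓ u) (i : K.Idx) :
    MemLp (fun t => K.normalDeriv u i t) 2 (volume.restrict (Ioo (0 : ℝ) 1)) :=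
  Polygon.memLp_normalDeriv h.hasL2Trace i (K.normal i)

/-- The degrees of freedom are not linear on arbitrary functions, because the integrals may diverge.
Membership in `Enlarged` makes all edge and interior integrands integrable and the normal traces
additive almost everywhere. -/
theorem dof_lin (B : DofBasis K ℓ) (h : Enlarged K ℓ u) (h' : Enlarged K ℓ w) (a b : ℝ) :
    dof B (a • u + b • w) = a • dof B u + b • dof B w := by
  ext (i | ⟨i, k⟩ | ⟨i, k⟩ | k)
  · simp [dof]
  · have e := K.edgeInt_lin i
      (integrableOn_Ioo_mul_continuous (h.memLp_edge i) (B.edge i k : Polynomial ℝ).continuous)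
      (integrableOn_Ioo_mul_continuous (h'.memLp_edge i) (B.edge i k : Polynomial ℝ).continuous) a b
    simp only [dof, Pi.add_apply, Pi.smul_apply, smul_eq_mul, add_mul, mul_assoc] at e ⊢
    rw [e]; ring
  · have e := K.edgeInt_lin i
      (integrableOn_Ioo_mul_continuous (h.memLp_normalDeriv i)
        (B.normal i k : Polynomial ℝ).continuous)
      (integrableOn_Ioo_mul_continuous (h'.memLp_normalDeriv i)
        (B.normal i k : Polynomial ℝ).continuous) a b
    simp only [dof, Pi.add_apply, Pi.smul_apply, smul_eq_mul]
    refine Eq.trans (K.edgeInt_congr i ?_) e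
    filter_upwards [Polygon.normalDerivAt_lin h.memH2.1 h'.memH2.1 h.hasL2Trace h'.hasL2Trace a b i
      (K.normal i)] with t ht
    simp only [Polygon.normalDeriv, ht]; ring
  · have hp := memLp_pval K.isBounded (B.inner k : MvPolynomial (Fin 2) ℝ) 2
    simp only [dof, Pi.add_apply, Pi.smul_apply, smul_eq_mul]
    have e := integral_lin_mul (h.memH2.1.1.integrable_mul hp) (h'.memH2.1.1.integrable_mul hp) a b
    simp only [Pi.add_apply, Pi.smul_apply, smul_eq_mul] at e
    rw [e]; ring

end Enlarged

/-! ### Linearity of the projections -/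

namespace Proj

variable {K : Polygon} {ℓ : ℕ} {B : DofBasis K ℓ} (P : Proj B) {u w : Pt → ℝ}

theorem val_lin (h : Enlarged K ℓ u) (h' : Enlarged K ℓ w) (a b : ℝ) :
    P.val (a • u + b • w) = a • P.val u + b • P.val w := by
  rw [val, dof_lin B h h', map_add, map_smul, map_smul]; rfl

theorem val_pval {q : MvPolynomial (Fin 2) ℝ} (hq : q ∈ polyDeg ℓ) : P.val (pval q) = q :=
  P.value_poly q hq

theorem val_mem (v : Pt → ℝ) : P.val v ∈ polyDeg ℓ := P.value_mem _

theorem grad_eq (v : Pt → ℝ) (i : Fin 2) :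
    P.grad v i = polyRiesz K (ℓ - 1) (partsFunctional K i (P.val v)
      fun e t => (P.edge e (dof B v)).eval t * K.normal e i) := by
  rw [grad]
  congr 1; ext r
  simp only [partsFunctional, mul_assoc, mul_comm (K.normal _ i)]

theorem hess_eq (v : Pt → ℝ) (i j : Fin 2) :
    P.hess v i j = polyRiesz K (ℓ - 2) (partsFunctional K j (P.grad v i)
      fun e t => (P.normal e (dof B v)).eval t * (K.normal e i * K.normal e j)
        + (K.len e)⁻¹ * (P.edge e (dof B v)).derivative.eval t
          * (K.tangent e i * K.normal e j)) := rfl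

theorem grad_lin (h : Enlarged K ℓ u) (h' : Enlarged K ℓ w) (a b : ℝ) (i : Fin 2) :
    P.grad (a • u + b • w) i = a • P.grad u i + b • P.grad w i := by
  have hc : ∀ v e, Continuous fun t => (P.edge e (dof B v)).eval t * K.normal e i :=
    fun v e => by fun_prop
  simp only [grad_eq]
  rw [← polyRiesz_lin K _ (partsFunctional_lin i _ (hc u)) (partsFunctional_lin i _ (hc w))]
  congr 1; ext r
  rw [← partsFunctional_data_lin i _ _ (hc u) (hc w), val_lin P h h', dof_lin B h h']
  congr 1; ext e t
  simp; ring

theorem hess_lin (h : Enlarged K ℓ u) (h' : Enlarged K ℓ w) (a b : ℝ) (i j : Fin 2) :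
    P.hess (a • u + b • w) i j = a • P.hess u i j + b • P.hess w i j := by
  have hc : ∀ v e, Continuous fun t =>
      (P.normal e (dof B v)).eval t * (K.normal e i * K.normal e j)
        + (K.len e)⁻¹ * (P.edge e (dof B v)).derivative.eval t
          * (K.tangent e i * K.normal e j) := fun v e => by fun_prop
  simp only [hess_eq]
  rw [← polyRiesz_lin K _ (partsFunctional_lin j _ (hc u)) (partsFunctional_lin j _ (hc w))]
  congr 1; ext r
  rw [← partsFunctional_data_lin j _ _ (hc u) (hc w), grad_lin P h h', dof_lin B h h']
  congr 1; ext e t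
  simp; ring

variable {P}

theorem Local.lin (h : P.Local u) (h' : P.Local w) (a b : ℝ) : P.Local (a • u + b • w) := by
  refine ⟨h.1.lin h'.1 a b, fun p hp hp' => ?_⟩
  have hi : ∀ {v}, P.Local v → Integrable (fun x => (v x - pval (P.val v) x) * pval p x)
      (volume.restrict K.carrier) := fun {v} hv =>
    (hv.1.memH2.1.1.sub (memLp_pval K.isBounded (P.val v) 2)).integrable_mul
      (memLp_pval K.isBounded p 2)
  have e := integral_lin_mul (hi h) (hi h') a b
  rw [h.2 p hp hp', h'.2 p hp hp', mul_zero, mul_zero, add_zero] at e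
  rw [← e, val_lin P h.1 h'.1, pval_lin]
  congr 1; ext x
  simp only [Pi.add_apply, Pi.smul_apply, smul_eq_mul]; ring

/-- The projection reproduces `q`, so the enhancement condition reads `0 = 0`. -/
theorem local_pval (hℓ : 2 ≤ ℓ) {q : MvPolynomial (Fin 2) ℝ} (hq : q ∈ polyDeg ℓ) :
    P.Local (pval q) :=
  ⟨enlarged_pval hℓ hq, fun p _ _ => by simp [val_pval P hq]⟩

end Proj

theorem sub_eq_smul_add_smul (u w : Pt → ℝ) : u - w = (1 : ℝ) • u + (-1 : ℝ) • w := by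
  simp [sub_eq_add_neg]

/-! ### The bilinear forms -/

/-- The energy of two pairs of a matrix field and a vector field. -/
def energy (ε : ℝ) (Φ : Pt → Matrix (Fin 2) (Fin 2) ℝ) (D : Set Pt)
    (H : Fin 2 → Fin 2 → Pt → ℝ) (G : Fin 2 → Pt → ℝ)
    (H' : Fin 2 → Fin 2 → Pt → ℝ) (G' : Fin 2 → Pt → ℝ) : ℝ :=
  ε * (∫ x in D, ∑ i, ∑ j, H i j x * H' i j x)
    + ∫ x in D, ∑ i, ∑ j, Φ x i j * G j x * G' i x

section Energy

variable {ε : ℝ} {Φ : Pt → Matrix (Fin 2) (Fin 2) ℝ} {D : Set Pt}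
  {H H₁ H₂ H' : Fin 2 → Fin 2 → Pt → ℝ} {G G₁ G₂ G' : Fin 2 → Pt → ℝ}

/-- Serves both forms: with weak derivatives for `AL`, with polynomial projections for `ALh`. Hence
the hypotheses on `H` and `G` are only almost-everywhere identities. -/
theorem energy_lin (hΦ : ∀ i j, MemLp (fun x => Φ x i j) ⊤ (volume.restrict D))
    (h₁ : ∀ i j, MemLp (H₁ i j) 2 (volume.restrict D))
    (h₂ : ∀ i j, MemLp (H₂ i j) 2 (volume.restrict D))
    (h' : ∀ i j, MemLp (H' i j) 2 (volume.restrict D))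
    (g₁ : ∀ i, MemLp (G₁ i) 2 (volume.restrict D)) (g₂ : ∀ i, MemLp (G₂ i) 2 (volume.restrict D))
    (g' : ∀ i, MemLp (G' i) 2 (volume.restrict D)) {a b : ℝ}
    (hH : ∀ i j, H i j =ᵐ[volume.restrict D] a • H₁ i j + b • H₂ i j)
    (hG : ∀ i, G i =ᵐ[volume.restrict D] a • G₁ i + b • G₂ i) :
    energy ε Φ D H G H' G' = a * energy ε Φ D H₁ G₁ H' G' + b * energy ε Φ D H₂ G₂ H' G' := by
  have i1 : ∀ {H : Fin 2 → Fin 2 → Pt → ℝ}, (∀ i j, MemLp (H i j) 2 (volume.restrict D)) →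
      Integrable (fun x => ∑ i, ∑ j, H i j x * H' i j x) (volume.restrict D) := fun hH =>
    integrable_finsetSum _ fun i _ => integrable_finsetSum _ fun j _ =>
      (hH i j).integrable_mul (h' i j)
  have i2 : ∀ {G : Fin 2 → Pt → ℝ}, (∀ i, MemLp (G i) 2 (volume.restrict D)) →
      Integrable (fun x => ∑ i, ∑ j, Φ x i j * G j x * G' i x) (volume.restrict D) := fun hG =>
    integrable_finsetSum _ fun i _ => integrable_finsetSum _ fun j _ =>
      ((hG j).mul (r := 2) (hΦ i j)).integrable_mul (g' i)
  have e1 : ∫ x in D, ∑ i, ∑ j, H i j x * H' i j x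
      = a * (∫ x in D, ∑ i, ∑ j, H₁ i j x * H' i j x)
        + b * ∫ x in D, ∑ i, ∑ j, H₂ i j x * H' i j x := by
    rw [← integral_const_mul, ← integral_const_mul,
      ← integral_add ((i1 h₁).const_mul a) ((i1 h₂).const_mul b)]
    refine integral_congr_ae ?_
    filter_upwards [hH 0 0, hH 0 1, hH 1 0, hH 1 1] with x x1 x2 x3 x4
    simp only [Fin.sum_univ_two, x1, x2, x3, x4, Pi.add_apply, Pi.smul_apply, smul_eq_mul]
    ring
  have e2 : ∫ x in D, ∑ i, ∑ j, Φ x i j * G j x * G' i x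
      = a * (∫ x in D, ∑ i, ∑ j, Φ x i j * G₁ j x * G' i x)
        + b * ∫ x in D, ∑ i, ∑ j, Φ x i j * G₂ j x * G' i x := by
    rw [← integral_const_mul, ← integral_const_mul,
      ← integral_add ((i2 g₁).const_mul a) ((i2 g₂).const_mul b)]
    refine integral_congr_ae ?_
    filter_upwards [hG 0, hG 1] with x x1 x2
    simp only [Fin.sum_univ_two, x1, x2, Pi.add_apply, Pi.smul_apply, smul_eq_mul]
    ring
  rw [energy, e1, e2, energy, energy]; ring

theorem energy_symm (hΦ : ∀ᵐ x ∂volume.restrict D, (Φ x).IsSymm) :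
    energy ε Φ D H G H' G' = energy ε Φ D H' G' H G := by
  have e1 : ∀ x, ∑ i, ∑ j, H i j x * H' i j x = ∑ i, ∑ j, H' i j x * H i j x := fun x =>
    Finset.sum_congr rfl fun i _ => Finset.sum_congr rfl fun j _ => mul_comm _ _
  have e2 : ∫ x in D, ∑ i, ∑ j, Φ x i j * G j x * G' i x
      = ∫ x in D, ∑ i, ∑ j, Φ x i j * G' j x * G i x := by
    refine integral_congr_ae ?_
    filter_upwards [hΦ] with x hx
    have := hx.apply 0 1
    simp only [Fin.sum_univ_two, this]; ring
  rw [energy, energy, e2]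
  simp only [e1]

theorem energy_nonneg (hε : 0 ≤ ε)
    (hΦ : ∀ᵐ x ∂volume.restrict D, ∀ ξ : Fin 2 → ℝ, 0 ≤ ξ ⬝ᵥ (Φ x *ᵥ ξ)) :
    0 ≤ energy ε Φ D H G H G := by
  refine add_nonneg (mul_nonneg hε (integral_nonneg fun x =>
    Finset.sum_nonneg fun i _ => Finset.sum_nonneg fun j _ => mul_self_nonneg _))
    (integral_nonneg_of_ae ?_)
  filter_upwards [hΦ] with x hx
  have := hx fun i => G i x
  simp only [dotProduct, Matrix.mulVec, Fin.sum_univ_two] at this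
  simp only [Fin.sum_univ_two, Pi.zero_apply]
  linarith

theorem AL_lin (hD : IsOpen D) (hΦ : ∀ i j, MemLp (fun x => Φ x i j) ⊤ (volume.restrict D))
    {u₁ u₂ w : Pt → ℝ} (h₁ : MemH2 D u₁) (h₂ : MemH2 D u₂) (h : MemH2 D w) (a b : ℝ) :
    AL ε Φ D (a • u₁ + b • u₂) w = a * AL ε Φ D u₁ w + b * AL ε Φ D u₂ w :=
  energy_lin (H := fun i j => weakD D j (weakD D i (a • u₁ + b • u₂)))
    (H₁ := fun i j => weakD D j (weakD D i u₁)) (H₂ := fun i j => weakD D j (weakD D i u₂))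
    (H' := fun i j => weakD D j (weakD D i w)) (G := fun i => weakD D i (a • u₁ + b • u₂))
    (G₁ := fun i => weakD D i u₁) (G₂ := fun i => weakD D i u₂) (G' := fun i => weakD D i w)
    hΦ h₁.memLp_weakD₂ h₂.memLp_weakD₂ h.memLp_weakD₂ h₁.1.memLp_weakD h₂.1.memLp_weakD
    h.1.memLp_weakD (h₁.weakD₂_lin hD h₂ a b) (h₁.1.weakD_lin hD h₂.1 a b)

end Energy

section ALh

variable {ε : ℝ} {Φ : Pt → Matrix (Fin 2) (Fin 2) ℝ} {K : Polygon} {ℓ : ℕ} {B : DofBasis K ℓ}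
  {P : Proj B} {u w z : Pt → ℝ}

theorem ALh_eq (u w : Pt → ℝ) : ALh ε Φ P u w
    = energy ε Φ K.carrier (fun i j => pval (P.hess u i j)) (fun i => pval (P.grad u i))
        (fun i j => pval (P.hess w i j)) (fun i => pval (P.grad w i))
      + stab ε Φ B (fun x => u x - pval (P.val u) x) (fun x => w x - pval (P.val w) x) := rfl

theorem dof_sub_val_lin (hℓ : 2 ≤ ℓ) (hu : P.Local u) (hw : P.Local w) (a b : ℝ) :
    dof B (fun x => (a • u + b • w) x - pval (P.val (a • u + b • w)) x)
      = a • dof B (fun x => u x - pval (P.val u) x)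
        + b • dof B (fun x => w x - pval (P.val w) x) := by
  have hE : ∀ {v}, P.Local v → Enlarged K ℓ fun x => v x - pval (P.val v) x := fun {v} hv => by
    have := hv.1.lin (enlarged_pval hℓ (P.val_mem v)) 1 (-1)
    rwa [← sub_eq_smul_add_smul] at this
  rw [← dof_lin B (hE hu) (hE hw)]
  congr 1; ext x
  rw [P.val_lin hu.1 hw.1, pval_lin]
  simp only [Pi.add_apply, Pi.smul_apply, smul_eq_mul]; ring

/-- The second argument may be arbitrary: its projections are polynomials in any case, and the
stabilisation is a finite sum. -/
theorem ALh_lin (hℓ : 2 ≤ ℓ)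
    (hΦ : ∀ i j, MemLp (fun x => Φ x i j) ⊤ (volume.restrict K.carrier))
    (hu : P.Local u) (hw : P.Local w) (z : Pt → ℝ) (a b : ℝ) :
    ALh ε Φ P (a • u + b • w) z = a * ALh ε Φ P u z + b * ALh ε Φ P w z := by
  have hm := fun p => memLp_pval K.isBounded p 2
  simp only [ALh_eq]
  rw [energy_lin hΦ (H₁ := fun i j => pval (P.hess u i j)) (H₂ := fun i j => pval (P.hess w i j))
    (G₁ := fun i => pval (P.grad u i)) (G₂ := fun i => pval (P.grad w i)) (fun _ _ => hm _)
    (fun _ _ => hm _) (fun _ _ => hm _) (fun _ => hm _) (fun _ => hm _) (fun _ => hm _)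
    (fun i j => by rw [P.hess_lin hu.1 hw.1, pval_lin])
    (fun i => by rw [P.grad_lin hu.1 hw.1, pval_lin]), stab, dof_sub_val_lin hℓ hu hw]
  simp only [stab, Pi.add_apply, Pi.smul_apply, smul_eq_mul, add_mul, mul_assoc,
    Finset.sum_add_distrib, ← Finset.mul_sum]
  ring

theorem ALh_symm (hΦ : ∀ᵐ x ∂volume.restrict K.carrier, (Φ x).IsSymm) (u w : Pt → ℝ) :
    ALh ε Φ P u w = ALh ε Φ P w u := by
  rw [ALh_eq, ALh_eq, energy_symm hΦ, stab, stab]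
  exact congrArg _ (congrArg _ (Finset.sum_congr rfl fun _ _ => mul_comm _ _))

theorem ALh_nonneg (hε : 0 ≤ ε)
    (hΦ : ∀ᵐ x ∂volume.restrict K.carrier, ∀ ξ : Fin 2 → ℝ, 0 ≤ ξ ⬝ᵥ (Φ x *ᵥ ξ)) (u : Pt → ℝ) :
    0 ≤ ALh ε Φ P u u :=
  add_nonneg (energy_nonneg hε hΦ) (mul_nonneg (add_nonneg (by positivity) ENNReal.toReal_nonneg)
    (Finset.sum_nonneg fun _ _ => mul_self_nonneg _))

/-- The Cauchy-Schwarz inequality for the discrete form. -/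
theorem ALh_sq_le (hℓ : 2 ≤ ℓ) (hε : 0 ≤ ε)
    (hΦ : ∀ i j, MemLp (fun x => Φ x i j) ⊤ (volume.restrict K.carrier))
    (hΦs : ∀ᵐ x ∂volume.restrict K.carrier, (Φ x).IsSymm)
    (hΦp : ∀ᵐ x ∂volume.restrict K.carrier, ∀ ξ : Fin 2 → ℝ, 0 ≤ ξ ⬝ᵥ (Φ x *ᵥ ξ))
    (hu : P.Local u) (hw : P.Local w) :
    ALh ε Φ P u w ^ 2 ≤ ALh ε Φ P u u * ALh ε Φ P w w := by
  -- The quadratic `t ↦ ALh(u + t w, u + t w)` is nonnegative, so its discriminant is at most zero.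
  have key : ∀ t : ℝ, 0 ≤ ALh ε Φ P w w * (t * t) + 2 * ALh ε Φ P u w * t + ALh ε Φ P u u := by
    intro t
    have h0 := ALh_nonneg (P := P) hε hΦp ((1 : ℝ) • u + t • w)
    rw [ALh_lin hℓ hΦ hu hw, ALh_symm hΦs u, ALh_symm hΦs w, ALh_lin hℓ hΦ hu hw,
      ALh_lin hℓ hΦ hu hw, ALh_symm hΦs w u] at h0
    linarith
  have := discrim_le_zero key
  rw [discrim] at this
  linarith

end ALh

/-! ### The coefficient matrix -/

section Cofactor

variable {D : Set Pt} {u : Pt → ℝ}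

/-- In dimension two the cofactors are the Hessian entries up to sign and position, so no products
have to be estimated. -/
theorem memLp_cofHess (hu : ∀ i j, MemLp (weakD D j (weakD D i u)) ⊤ (volume.restrict D))
    (i j : Fin 2) : MemLp (fun x => cofHess D u x i j) ⊤ (volume.restrict D) := by
  fin_cases i <;> fin_cases j <;> simp [cofHess, Matrix.adjugate_fin_two, hess]
  exacts [hu 1 1, (hu 1 0).neg, (hu 0 1).neg, hu 0 0]

theorem isSymm_cofHess (hD : IsOpen D) (h : MemH2 D u) :
    ∀ᵐ x ∂volume.restrict D, (cofHess D u x).IsSymm := by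
  filter_upwards [h.weakD₂_comm hD 0 1] with x hx
  ext i j
  fin_cases i <;> fin_cases j <;> simp [cofHess, Matrix.adjugate_fin_two, hess, hx]

end Cofactor

/-! ### The mesh -/

section Mesh

variable {Ω : Set Pt} {ι : Type} [Fintype ι] (M : Mesh Ω ι)

theorem Mesh.norm_nonneg (u : ι → Pt → ℝ) : 0 ≤ M.norm u := Real.sqrt_nonneg _

/-- The broken norm is one `ℓ²` sum over pairs of an element and a derivative, so Minkowski's
inequality applies once to the whole family. -/
theorem Mesh.norm_sub_le {u w : ι → Pt → ℝ} (hu : ∀ k, MemH2 (M.elem k).carrier (u k))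
    (hw : ∀ k, MemH2 (M.elem k).carrier (w k)) :
    M.norm (fun k => u k - w k) ≤ M.norm u + M.norm w := by
  have e : ∀ v : ι → Pt → ℝ, M.norm v = Real.sqrt (∑ o : ι × Option (Fin 2 ⊕ Fin 2 × Fin 2),
      ∫ x in (M.elem o.1).carrier, jet (M.elem o.1).carrier (v o.1) o.2 x ^ 2) := by
    intro v
    rw [Mesh.norm, Fintype.sum_prod_type]
    simp only [normH2_sq]
  have h := sqrt_sum_integral_sq_lin_le
    (μ := fun o : ι × Option (Fin 2 ⊕ Fin 2 × Fin 2) => volume.restrict (M.elem o.1).carrier)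
    (fun o => (hu o.1).memLp_jet o.2) (fun o => (hw o.1).memLp_jet o.2) 1 (-1)
  rw [abs_neg, abs_one, one_mul, one_mul, ← e, ← e] at h
  refine le_trans (le_of_eq ?_) h
  rw [e]; congr 1
  refine Finset.sum_congr rfl fun o _ => integral_congr_ae ?_
  rw [sub_eq_smul_add_smul]
  exact ((hu o.1).jet_lin (M.elem o.1).isOpen (hw o.1) 1 (-1) o.2).fun_comp (· ^ 2)

theorem Mesh.sum_normH2_mul_le (u w : ι → Pt → ℝ) :
    ∑ k, normH2 (M.elem k).carrier (u k) * normH2 (M.elem k).carrier (w k)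
      ≤ M.norm u * M.norm w :=
  Real.sum_mul_le_sqrt_mul_sqrt _ _ _

theorem Mesh.bdryInt_sub {f g : (k : ι) → (M.elem k).Idx → ℝ → ℝ}
    (hf : ∀ k i, M.IsBdry k i → IntegrableOn (f k i) (Ioo 0 1))
    (hg : ∀ k i, M.IsBdry k i → IntegrableOn (g k i) (Ioo 0 1)) :
    M.bdryInt (fun k i t => f k i t - g k i t) = M.bdryInt f - M.bdryInt g := by
  simp only [Mesh.bdryInt, ← Finset.sum_sub_distrib]
  refine Finset.sum_congr rfl fun k _ => Finset.sum_congr rfl fun i _ => ?_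
  split_ifs with h
  · have := (M.elem k).edgeInt_lin i (hf k i h) (hg k i h) 1 (-1)
    simp only [one_mul, neg_mul, ← sub_eq_add_neg] at this
    exact this
  · simp

end Mesh

theorem Mesh.Shared.pt_eq {Ω : Set Pt} {ι : Type} {M : Mesh Ω ι} {k l : ι}
    {i : (M.elem k).Idx} {j : (M.elem l).Idx} (h : M.Shared k l i j) (t : ℝ) : (M.elem k).pt i t = (M.elem l).pt j (1 - t) := by
  rw [Polygon.pt, Polygon.pt, h.2.1, h.2.2, AffineMap.lineMap_apply_one_sub]

/-- Neighbouring elements traverse a shared edge in opposite directions; this carries `L²` bounds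
and null sets from one parametrization to the other. -/
theorem measurePreserving_one_sub_Ioo : MeasurePreserving (fun t : ℝ => 1 - t)
    (volume.restrict (Ioo (0 : ℝ) 1)) (volume.restrict (Ioo (0 : ℝ) 1)) := by
  have h := (Measure.measurePreserving_sub_left (volume : Measure ℝ) 1).restrict_preimage
    (measurableSet_Ioo (a := (0 : ℝ)) (b := 1))
  have e : (fun t : ℝ => 1 - t) ⁻¹' Ioo 0 1 = Ioo 0 1 := by
    ext t; simp only [mem_preimage, mem_Ioo]
    constructor <;> rintro ⟨h1, h2⟩ <;> constructor <;> linarith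
  rwa [e] at h

/-! ### Functions vanishing on the boundary -/

theorem IsTest.hasWeakDeriv {D D' : Set Pt} {φ : Pt → ℝ} (hφ : IsTest D φ) (i : Fin 2) :
    HasWeakDeriv D' i φ (VEM.pd i φ) := by
  refine ⟨(hφ.pd i).memLp 2 _, fun χ hχ => ?_⟩
  rw [(hχ.pd i).setIntegral_eq, hχ.setIntegral_eq]
  have hc : ∀ {f g : Pt → ℝ}, Continuous f → Continuous g → HasCompactSupport g →
      Integrable (fun x => f x * g x) := fun hf hg hgc =>
    (hf.mul hg).integrable_of_hasCompactSupport hgc.mul_left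
  exact integral_mul_fderiv_eq_neg_fderiv_mul_of_integrable (μ := (volume : Measure Pt))
    (hc (continuous_pd hφ.1 i) hχ.1.continuous hχ.2.1)
    (hc hφ.1.continuous (continuous_pd hχ.1 i) (hχ.pd i).2.1)
    (hc hφ.1.continuous hχ.1.continuous hχ.2.1)
    (fun x _ => hφ.1.differentiable (by simp) x) (fun x _ => hχ.1.differentiable (by simp) x)

theorem IsTest.memH1 {D D' : Set Pt} {φ : Pt → ℝ} (hφ : IsTest D φ) : MemH1 D' φ :=
  ⟨hφ.memLp 2 _, fun i => ⟨_, hφ.hasWeakDeriv i⟩⟩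

theorem MemH10.sub {D : Set Pt} {u w : Pt → ℝ} (hD : IsOpen D) (hu : MemH10 D u)
    (hw : MemH10 D w) : MemH10 D (u - w) := by
  refine ⟨?_, fun η hη => ?_⟩
  · rw [sub_eq_smul_add_smul]; exact hu.1.lin hw.1 1 (-1)
  obtain ⟨φ, hφ, h1⟩ := hu.2 (η / 2) (half_pos hη)
  obtain ⟨χ, hχ, h2⟩ := hw.2 (η / 2) (half_pos hη)
  refine ⟨φ - χ, ?_, ?_⟩
  · rw [sub_eq_smul_add_smul]; exact hφ.lin hχ 1 (-1)
  have hm : ∀ {v θ : Pt → ℝ}, MemH1 D v → IsTest D θ → MemH1 D fun x => v x - θ x :=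
    fun {v θ} hv hθ => by
      have := hv.lin (hθ.memH1 (D' := D)) 1 (-1)
      rwa [← sub_eq_smul_add_smul] at this
  have h3 := normH1_lin_le hD (hm hu.1 hφ) (hm hw.1 hχ) 1 (-1)
  rw [abs_neg, abs_one, one_mul, one_mul, ← sub_eq_smul_add_smul] at h3
  have e : (fun x => (u - w) x - (φ - χ) x) = (fun x => u x - φ x) - fun x => w x - χ x := by
    ext x; simp only [Pi.sub_apply]; ring
  rw [e]; linarith

/-! ### The discrete space -/

section Vh

variable {Ω : Set Pt} {ι : Type} {M : Mesh Ω ι} {ℓ : ℕ}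
  {B : (k : ι) → DofBasis (M.elem k) ℓ} {P : (k : ι) → Proj (B k)} {u w : Pt → ℝ}

theorem Proj.Local.sub {K : Polygon} {B : DofBasis K ℓ} {P : Proj B} (hu : P.Local u)
    (hw : P.Local w) : P.Local (u - w) := by
  rw [sub_eq_smul_add_smul]; exact hu.lin hw 1 (-1)

/-- Only the jump condition is delicate: the integral must be split, which needs `L²` normal traces
and their additivity from both sides of the edge. Those of the neighbour `l` are known in its own
parameter and are transported by `t ↦ 1 - t`. -/
theorem sub_mem_Vh (hΩ : IsOpen Ω) (hu : u ∈ Vh M P) (hw : w ∈ Vh M P) : u - w ∈ Vh M P := by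
  refine ⟨⟨fun k => ?_, hu.1.2.1.sub hΩ hw.1.2.1, fun k l i j hs p hp => ?_⟩,
    hu.2.1.sub hw.2.1, fun k => (hu.2.2 k).sub (hw.2.2 k)⟩
  · exact ((hu.2.2 k).sub (hw.2.2 k)).1.memH2
  have hl := fun v (hv : v ∈ Vh M P) (n : Pt) =>
    (Polygon.memLp_normalDeriv (hv.2.2 l).1.hasL2Trace j n).comp_measurePreserving
      measurePreserving_one_sub_Ioo
  have hint : ∀ v ∈ Vh M P, IntegrableOn (fun t =>
      (normalDerivAt (M.elem k).carrier v ((M.elem k).normal i) ((M.elem k).pt i t)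
        - normalDerivAt (M.elem l).carrier v ((M.elem k).normal i) ((M.elem k).pt i t))
          * p.eval t) (Ioo 0 1) := fun v hv => by
    refine integrableOn_Ioo_mul_continuous
      (((hv.2.2 k).1.memLp_normalDeriv i).sub ?_) p.continuous
    simp only [hs.pt_eq]
    exact hl v hv ((M.elem k).normal i)
  have e := (M.elem k).edgeInt_lin i (hint u hu) (hint w hw) 1 (-1)
  rw [hu.1.2.2 k l i j hs p hp, hw.1.2.2 k l i j hs p hp, mul_zero, mul_zero, add_zero] at e
  refine Eq.trans ((M.elem k).edgeInt_congr i ?_) e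
  have hk' := Polygon.normalDerivAt_lin (hu.2.2 k).1.memH2.1 (hw.2.2 k).1.memH2.1
    (hu.2.2 k).1.hasL2Trace (hw.2.2 k).1.hasL2Trace 1 (-1) i ((M.elem k).normal i)
  have hl' := measurePreserving_one_sub_Ioo.quasiMeasurePreserving.ae
    (Polygon.normalDerivAt_lin (hu.2.2 l).1.memH2.1 (hw.2.2 l).1.memH2.1
      (hu.2.2 l).1.hasL2Trace (hw.2.2 l).1.hasL2Trace 1 (-1) j ((M.elem k).normal i))
  filter_upwards [hk', hl'] with t h1 h2
  rw [← hs.pt_eq] at h2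
  rw [sub_eq_smul_add_smul, h1, h2]; ring

theorem ofReal_div_le_dualNorm [Fintype ι] {F : (Pt → ℝ) → ℝ} {δ : Pt → ℝ} (hδ : δ ∈ Vh M P)
    (h : M.norm (fun _ => δ) ≠ 0) : ENNReal.ofReal (|F δ| / M.norm fun _ => δ) ≤ dualNorm M P F :=
  le_iSup₂_of_le δ hδ (le_iSup_of_le h le_rfl)

end Vh

end VEM

end

/-! ### The Strang-type error estimate -/

theorem theorem4p1
    {Ω : Set Pt} (hΩ : IsOpen Ω) (hΩc : Convex ℝ Ω)
    {ι : Type} [Fintype ι] (M : Mesh Ω ι)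
    {ℓ : ℕ} (hℓ : 2 ≤ ℓ)
    (B : (k : ι) → DofBasis (M.elem k) ℓ) (P : (k : ι) → Proj (B k))
    {ε : ℝ} (hε : 0 < ε)
    -- the strictly convex function at which the operator is linearised, and its cofactor matrix
    {uε : Pt → ℝ} (huε : MemH2 Ω uε)
    (huε_bdd : ∀ i j, MemLp (weakD Ω j (weakD Ω i uε)) ⊤ (volume.restrict Ω))
    {β : ℝ} (hβ : 0 < β)
    (huε_convex : ∀ᵐ x ∂volume.restrict Ω, ∀ ξ : Fin 2 → ℝ,
      β * (ξ ⬝ᵥ ξ) ≤ ξ ⬝ᵥ (cofHess Ω uε x *ᵥ ξ))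
    -- continuity and coercivity constants of the linearised form
    {C₂ C₃ : ℝ} (hC₂ : 0 < C₂) (hC₃ : 0 < C₃)
    (hcont : ∀ k u w, MemH2 (M.elem k).carrier u → MemH2 (M.elem k).carrier w →
      AL ε (cofHess Ω uε) (M.elem k).carrier u w
        ≤ C₂ * normH2 (M.elem k).carrier u * normH2 (M.elem k).carrier w)
    (hcoer : ∀ w ∈ Vh M P,
      C₃ * M.norm (fun _ => w) ^ 2 ≤ ∑ k, AL ε (cofHess Ω uε) (M.elem k).carrier w w)
    -- stability constants of the discrete form
    {αlow αup : ℝ} (hαlow : 0 < αlow) (hαup : 0 < αup)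
    (hstab : ∀ k w, (P k).Local w →
      αlow * AL ε (cofHess Ω uε) (M.elem k).carrier w w ≤ ALh ε (cofHess Ω uε) (P k) w w ∧
      ALh ε (cofHess Ω uε) (P k) w w ≤ αup * AL ε (cofHess Ω uε) (M.elem k).carrier w w)
    -- data and solutions
    {φ ψ : Pt → ℝ} (hφ : MemLp φ 2 (volume.restrict Ω))
    (hψ : ∀ k i, M.IsBdry k i →
      MemLp (fun t => ψ ((M.elem k).pt i t)) 2 (volume.restrict (Ioo (0 : ℝ) 1)))
    {v vh : Pt → ℝ} (hv : IsLinearSol ε (cofHess Ω uε) M φ ψ v)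
    (hvh : IsDiscreteSol ε (cofHess Ω uε) M P φ ψ vh) :
    ENNReal.ofReal (C₃ * αlow * M.norm fun _ => v - vh) ≤
      ENNReal.ofReal (αup * C₂ + C₃ * αlow)
          * (⨅ w ∈ Vh M P, ENNReal.ofReal (M.norm fun _ => v - w))
        + (⨅ p : ι → MvPolynomial (Fin 2) ℝ, ⨅ _ : ∀ k, p k ∈ polyDeg ℓ,
            (ENNReal.ofReal ((1 + αup) * C₂ * M.norm fun k => v - pval (p k))
              + ∑ k, dualNorm M P fun δ =>
                  AL ε (cofHess Ω uε) (M.elem k).carrier (pval (p k)) δ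
                    - ALh ε (cofHess Ω uε) (P k) (pval (p k)) δ))
        + dualNorm M P (fun δ => nonconfError ε (cofHess Ω uε) M φ ψ v δ)
        + dualNorm M P (fun δ => ε * M.bdryInt fun k i t =>
            ψ ((M.elem k).pt i t) * (((P k).normal i (dof (B k) δ)).eval t
              - (M.elem k).normalDeriv δ i t)) := by
  set Φ := cofHess Ω uε with hΦdef
  have hsub := M.subset
  have hmono : ∀ k, volume.restrict (M.elem k).carrier ≤ volume.restrict Ω :=
    fun k => Measure.restrict_mono_set _ (hsub k)
  have hΦ : ∀ k i j, MemLp (fun x => Φ x i j) ⊤ (volume.restrict (M.elem k).carrier) :=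
    fun k i j => (memLp_cofHess huε_bdd i j).mono_measure (hmono k)
  have hΦs : ∀ k, ∀ᵐ x ∂volume.restrict (M.elem k).carrier, (Φ x).IsSymm :=
    fun k => ae_mono (hmono k) (isSymm_cofHess hΩ huε)
  have hΦp : ∀ k, ∀ᵐ x ∂volume.restrict (M.elem k).carrier,
      ∀ ξ : Fin 2 → ℝ, 0 ≤ ξ ⬝ᵥ (Φ x *ᵥ ξ) := fun k => by
    filter_upwards [ae_mono (hmono k) huε_convex] with x hx ξ
    exact (mul_nonneg hβ.le (Finset.sum_nonneg fun i _ => mul_self_nonneg (ξ i))).trans (hx ξ)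
  have hvK : ∀ k, MemH2 (M.elem k).carrier v := fun k => hv.1.1.mono (M.elem k).isOpen (hsub k)
  have hVK : ∀ {z}, z ∈ Vh M P → ∀ k, MemH2 (M.elem k).carrier z :=
    fun hz k => (hz.2.2 k).1.memH2
  have hpK : ∀ (p : MvPolynomial (Fin 2) ℝ) k, MemH2 (M.elem k).carrier (pval p) :=
    fun p k => memH2_pval (M.elem k).isOpen (M.elem k).isBounded p
  have hsubK : ∀ {a b : Pt → ℝ} k, MemH2 (M.elem k).carrier a → MemH2 (M.elem k).carrier b →
      MemH2 (M.elem k).carrier (a - b) := fun {a b} k ha hb => by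
    rw [sub_eq_smul_add_smul]; exact ha.lin (M.elem k).isOpen hb 1 (-1)
  -- In `[0, ∞]` a factor passes through an infimum when it is neither `0` nor `∞`. Once both infima
  -- are outermost, it suffices to treat fixed `p` and `w`.
  rw [ENNReal.mul_iInf_of_ne (by simp; positivity) ENNReal.ofReal_ne_top]
  simp only [ENNReal.mul_iInf_of_ne (show ENNReal.ofReal (αup * C₂ + C₃ * αlow) ≠ 0 by
    simp; positivity) ENNReal.ofReal_ne_top, ENNReal.iInf_add, ENNReal.add_iInf]
  refine le_iInf₂ fun p hp => le_iInf₂ fun w hw => ?_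
  have hδ : vh - w ∈ Vh M P := sub_mem_Vh hΩ hvh.1 hw
  set δ := vh - w with hδdef
  set N := M.norm fun _ => δ with hN
  have hN0 : 0 ≤ N := M.norm_nonneg _
  set X := M.norm fun _ => v - w with hX
  set Y := M.norm fun k => v - pval (p k) with hY
  set S : ι → (Pt → ℝ) → ℝ := fun k δ => AL ε Φ (M.elem k).carrier (pval (p k)) δ
    - ALh ε Φ (P k) (pval (p k)) δ with hS
  set E : (Pt → ℝ) → ℝ := fun δ => nonconfError ε Φ M φ ψ v δ with hE
  set G : (Pt → ℝ) → ℝ := fun δ => ε * M.bdryInt fun k i t =>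
    ψ ((M.elem k).pt i t) * (((P k).normal i (dof (B k) δ)).eval t
      - (M.elem k).normalDeriv δ i t) with hG
  have hvvh : M.norm (fun _ => v - vh) ≤ X + N := by
    have h := M.norm_sub_le (u := fun _ => v - w) (w := fun _ => δ)
      (fun k => hsubK k (hvK k) (hVK hw k)) (hVK hδ)
    have e : (fun _ : ι => v - w - δ) = fun _ => v - vh := by
      rw [hδdef]; ext; simp
    rwa [e] at h
  have hwp : M.norm (fun k => w - pval (p k)) ≤ Y + X := by
    have h := M.norm_sub_le (u := fun k => v - pval (p k)) (w := fun _ => v - w)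
      (fun k => hsubK k (hvK k) (hpK _ k)) (fun k => hsubK k (hvK k) (hVK hw k))
    have e : (fun k => v - pval (p k) - (v - w)) = fun k => w - pval (p k) := by
      ext; simp
    rwa [e] at h
  have herr : C₃ * αlow * N ^ 2 ≤ E δ + G δ + ∑ k, S k δ + C₂ * (Y * N)
      + αup * C₂ * (M.norm (fun k => w - pval (p k)) * N) := by
    have hlow : C₃ * αlow * N ^ 2 ≤ ∑ k, ALh ε Φ (P k) δ δ := by
      calc C₃ * αlow * N ^ 2 = αlow * (C₃ * N ^ 2) := by ring
        _ ≤ αlow * ∑ k, AL ε Φ (M.elem k).carrier δ δ :=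
          mul_le_mul_of_nonneg_left (hcoer δ hδ) hαlow.le
        _ ≤ ∑ k, ALh ε Φ (P k) δ δ := by
          rw [Finset.mul_sum]
          exact Finset.sum_le_sum fun k _ => (hstab k δ (hδ.2.2 k)).1
    -- The elementwise identity behind the estimate: `v` and `p` are inserted so that every
    -- remaining difference is a named error or is small by approximation.
    have hexp : ∀ k, ALh ε Φ (P k) δ δ = ALh ε Φ (P k) vh δ - AL ε Φ (M.elem k).carrier v δ
        + S k δ + AL ε Φ (M.elem k).carrier (v - pval (p k)) δ
        - ALh ε Φ (P k) (w - pval (p k)) δ := fun k => by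
      have e1 : ALh ε Φ (P k) δ δ = ALh ε Φ (P k) vh δ - ALh ε Φ (P k) w δ := by
        have h := ALh_lin (ε := ε) hℓ (hΦ k) (hvh.1.2.2 k) (hw.2.2 k) δ 1 (-1)
        rw [← sub_eq_smul_add_smul, ← hδdef] at h
        linarith
      have e2 : ALh ε Φ (P k) (w - pval (p k)) δ
          = ALh ε Φ (P k) w δ - ALh ε Φ (P k) (pval (p k)) δ := by
        rw [sub_eq_smul_add_smul w, ALh_lin hℓ (hΦ k) (hw.2.2 k) (Proj.local_pval hℓ (hp k))]
        ring
      have e3 : AL ε Φ (M.elem k).carrier (v - pval (p k)) δ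
          = AL ε Φ (M.elem k).carrier v δ - AL ε Φ (M.elem k).carrier (pval (p k)) δ := by
        rw [sub_eq_smul_add_smul v, AL_lin (M.elem k).isOpen (hΦ k) (hvK k) (hpK _ k) (hVK hδ k)]
        ring
      simp only [hS]
      linarith
    have hsum : ∑ k, ALh ε Φ (P k) δ δ = E δ + G δ + ∑ k, S k δ
        + ∑ k, AL ε Φ (M.elem k).carrier (v - pval (p k)) δ
        - ∑ k, ALh ε Φ (P k) (w - pval (p k)) δ := by
      -- The discrete load uses the projected normal derivative, the nonconformity error the exact
      -- one; `G` is the difference.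
      have hbdry : G δ = ε * (M.bdryInt fun k i t =>
            ψ ((M.elem k).pt i t) * ((P k).normal i (dof (B k) δ)).eval t)
          - ε * M.bdryInt fun k i t => ψ ((M.elem k).pt i t) * (M.elem k).normalDeriv δ i t := by
        rw [← mul_sub, ← M.bdryInt_sub]
        · simp only [hG, mul_sub]
        · exact fun k i h => integrableOn_Ioo_mul_continuous (hψ k i h) (Polynomial.continuous _)
        · exact fun k i h => (hψ k i h).integrable_mul ((hδ.2.2 k).1.memLp_normalDeriv i)
      rw [Finset.sum_congr rfl fun k _ => hexp k, Finset.sum_sub_distrib, Finset.sum_add_distrib,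
        Finset.sum_add_distrib, Finset.sum_sub_distrib, hvh.2 δ hδ, hbdry]
      simp only [hE, nonconfError]
      ring
    have hAL : ∑ k, AL ε Φ (M.elem k).carrier (v - pval (p k)) δ ≤ C₂ * (Y * N) := by
      refine le_trans (Finset.sum_le_sum fun k _ =>
        hcont k _ _ (hsubK k (hvK k) (hpK (p k) k)) (hVK hδ k)) ?_
      simp only [mul_assoc]
      rw [← Finset.mul_sum]
      exact mul_le_mul_of_nonneg_left (M.sum_normH2_mul_le _ _) hC₂.le
    -- Stability bounds the discrete form only on the diagonal. Cauchy-Schwarz on each element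
    -- yields the off-diagonal bound, and a second Cauchy-Schwarz sums over the elements.
    have hALh : -∑ k, ALh ε Φ (P k) (w - pval (p k)) δ
        ≤ αup * C₂ * (M.norm (fun k => w - pval (p k)) * N) := by
      rw [← Finset.sum_neg_distrib]
      refine le_trans (Finset.sum_le_sum fun k _ => ?_)
        ((Finset.mul_sum _ _ _).symm.le.trans (mul_le_mul_of_nonneg_left
          (M.sum_normH2_mul_le (fun k => w - pval (p k)) fun _ => δ) (mul_pos hαup hC₂).le))
      have hloc : (P k).Local (w - pval (p k)) := (hw.2.2 k).sub (Proj.local_pval hℓ (hp k))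
      have hup : ∀ z, (P k).Local z →
          ALh ε Φ (P k) z z ≤ αup * C₂ * normH2 (M.elem k).carrier z ^ 2 := fun z hz => by
        refine (hstab k z hz).2.trans ?_
        have := mul_le_mul_of_nonneg_left (hcont k z z hz.1.memH2 hz.1.memH2) hαup.le
        linarith
      have hcs := ALh_sq_le hℓ hε.le (hΦ k) (hΦs k) (hΦp k) hloc (hδ.2.2 k)
      have hprod := mul_le_mul (hup _ hloc) (hup δ (hδ.2.2 k))
        (ALh_nonneg (P := P k) hε.le (hΦp k) δ) (by positivity)
      refine (neg_le_abs _).trans (abs_le_of_sq_le_sq ?_ ?_)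
      · refine hcs.trans (hprod.trans (le_of_eq ?_)); ring
      · exact mul_nonneg (by positivity) (mul_nonneg normH2_nonneg normH2_nonneg)
    linarith
  have hX0 : 0 ≤ X := M.norm_nonneg _
  have hY0 : 0 ≤ Y := M.norm_nonneg _
  have hc : 0 < C₃ * αlow := mul_pos hC₃ hαlow
  have hαC : 0 < αup * C₂ := mul_pos hαup hC₂
  have hdiv : C₃ * αlow * N ≤ αup * C₂ * X + (1 + αup) * C₂ * Y
      + ∑ k, |S k δ| / N + |E δ| / N + |G δ| / N := by
    -- If `N = 0`, the left side vanishes and division by zero makes each quotient `0`; otherwise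
    -- the quadratic estimate is divided by `N`.
    rcases hN0.eq_or_lt with h0 | h0
    · rw [← h0]; simp only [div_zero, Finset.sum_const_zero, mul_zero, add_zero]; positivity
    · have hSs : ∑ k, S k δ ≤ ∑ k, |S k δ| := Finset.sum_le_sum fun k _ => le_abs_self _
      have hwp' := mul_le_mul_of_nonneg_left (mul_le_mul_of_nonneg_right hwp hN0) hαC.le
      rw [← Finset.sum_div]
      refine le_of_mul_le_mul_right ?_ h0
      have e : (αup * C₂ * X + (1 + αup) * C₂ * Y + (∑ k, |S k δ|) / N + |E δ| / N + |G δ| / N) * N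
          = αup * C₂ * X * N + (1 + αup) * C₂ * Y * N + ∑ k, |S k δ| + |E δ| + |G δ| := by
        field_simp
      rw [e]
      linarith [le_abs_self (E δ), le_abs_self (G δ)]
  -- The triangle inequality through `w` adds `C₃ αlow X`, which completes the factor `αup C₂ + C₃
  -- αlow`.
  have hfin : C₃ * αlow * M.norm (fun _ => v - vh) ≤ (αup * C₂ + C₃ * αlow) * X
      + ((1 + αup) * C₂ * Y + ∑ k, |S k δ| / N) + |E δ| / N + |G δ| / N := by
    linarith [mul_le_mul_of_nonneg_left hvvh hc.le]
  -- The supremum excludes functions of norm zero; for these the quotient is `0`, so the bound still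
  -- holds.
  have hdual : ∀ F : (Pt → ℝ) → ℝ, ENNReal.ofReal (|F δ| / N) ≤ dualNorm M P F := fun F => by
    rcases eq_or_ne N 0 with h0 | h0
    · simp [h0]
    · exact ofReal_div_le_dualNorm hδ h0
  refine (ENNReal.ofReal_le_ofReal hfin).trans ?_
  have hq : ∀ F : (Pt → ℝ) → ℝ, 0 ≤ |F δ| / N := fun F => div_nonneg (abs_nonneg _) hN0
  have hqs : 0 ≤ ∑ k, |S k δ| / N := Finset.sum_nonneg fun k _ => hq (S k)
  rw [ENNReal.ofReal_add (by have := hq E; positivity) (hq G),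
    ENNReal.ofReal_add (by positivity) (hq E), ENNReal.ofReal_add (by positivity) (by positivity),
    ENNReal.ofReal_add (by positivity) hqs, ENNReal.ofReal_mul (by positivity),
    ENNReal.ofReal_sum_of_nonneg fun k _ => hq (S k)]
  exact add_le_add (add_le_add (add_le_add le_rfl (add_le_add le_rfl
    (Finset.sum_le_sum fun k _ => hdual (S k)))) (hdual E)) (hdual G)
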